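/- Let $\Theta$ be a finite alphabet, $\Xi=\Theta^{\mathbb N}$ with the $\sigma$-algebra generated by the cylinder sets, $\sigma$ the shift on $\Xi$, and $\nu$ a $\sigma$-invariant ergodic probability measure on $\Xi$. Let $(X,\mu)$ be a probability space and $(T_\theta)_{\theta\in\Theta}$ a family of $\mu$-preserving maps $X\to X$. Assume that the step skew product $T(\alpha,x)=(\sigma\alpha,T_{\alpha_0}x)$ on $\Xi\times X$ is ergodic with respect to $\nu\otimes\mu$. Put $T_{\alpha,0}=\mathrm{Id}$ and $T_{\alpha,n}=T_{\alpha_{n-1}}\circ\dots\circ T_{\alpha_0}$. Let $\mathcal P$ be a finite partition of $X$, i.e. a finite collection of a.s. disjoint measurable sets of positive measure that cover $X$ up to a null set. A $\mathcal P$-$\alpha$-name of $x$ is a sequence $\omega\in\mathcal P^{\mathbb N}$ with $T_{\alpha,n}(x)\in\omega_n$ for all $n\in\mathbb N$. With binary logarithms, let $H_\mu(\mathcal Q)=-\sum_{Q\in\mathcal Q}\mu(Q)\log_2\mu(Q)$ and $$H^n_{\nu,\mu}(\mathcal P)=\int_\Xi H_\mu\Big(\bigvee_{i=0}^{n-1}T_{\alpha,i}^{-1}(\mathcal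 P)\Big)\,d\nu(\alpha).$$ An oracle machine is a Turing machine with input alphabet $\{0,1\}$ and output alphabet $\mathcal P$ and an additional read-only tape carrying an oracle $\alpha\in\Xi$. It is prefix free if for every oracle no input on which it terminates is a proper prefix of another one. Let $U$ be a universal oracle machine, i.e. for every oracle machine $M$ there is a word $w\in\{0,1\}^*$ such that for all oracles $\alpha$ and inputs $u$, $U$ terminates on $wu$ with oracle $\alpha$ if and only if $M$ terminates on $u$ with oracle $\alpha$, and then with the same output; or let $U$ be a universal prefix free oracle machine, i.e. $U$ is prefix free and has this property for all prefix free $M$. For a finite word $v$ over $\mathcal P$ let $C_U(v|\alpha)$ be the minimal length of an input $u$ on which $U$ with oracle $\alpha$ terminates with output $v$ ($\infty$ if there is none), and for $\omega\in\mathcal P^{\mathbb N}$ put $$\overline{\mathcal C}(\omega|\alpha)=\limsup_{n\to\infty}\tfrac1n C_U(\omega_0\dots\omega_{n-1}|\alpha),\qquad \underline{\mathcal C}(\omega|\alpha)=\liminf_{n\to\infty}\tfrac1n C_U(\omega_0\dots\omega_{n-1}|\alpha).$$ Then the limit $h_{\nu,\mu}(\mathcal P)=\lim_{n\to\infty}\frac1n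 H^n_{\nu,\mu}(\mathcal P)$ (the fiber entropy) exists, and for $\nu\otimes\mu$-almost every $(\alpha,x)$ the point $x$ has a unique $\mathcal P$-$\alpha$-name $\omega$, and $$\overline{\mathcal C}(\omega|\alpha)=\underline{\mathcal C}(\omega|\alpha)=h_{\nu,\mu}(\mathcal P).$$ -/

import Mathlib

open MeasureTheory Filter
open scoped ENNReal Topology

/-- One row of the program of an oracle machine: what the machine does in a single step. -/
structure OracleMachine.Action (State Work Λ : Type*) where
  /-- the state entered after the step -/
  next : State
  /-- the symbol written at the current cell of the work tape -/
  write : Work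
  /-- the move of the head on the work tape (`none`: it stays) -/
  workMove : Option Turing.Dir
  /-- whether the head on the input tape moves one cell to the right -/
  inputMove : Bool
  /-- whether the head on the oracle tape moves one cell to the right -/
  oracleMove : Bool
  /-- the symbol printed on the output tape (`none`: nothing is printed) -/
  print : Option Λ

/-- An oracle machine with input alphabet `{0,1}`, oracle alphabet `Θ` and output alphabet `Λ`.
It has a one-way read-only input tape, a one-way read-only oracle tape, a bi-infinite work tape and
a one-way write-only output tape. The blank work symbol is `default`; a blank cell of the input
tape (behind the input word) is read as `none`. -/
structure OracleMachine (Θ Λ : Type*) where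
  State : Type
  Work : Type
  [stateFintype : Fintype State]
  [workFintype : Fintype Work]
  [workInhabited : Inhabited Work]
  start : State
  isStop : State → Bool
  /-- the program: current state, scanned input, work and oracle symbols ↦ action -/
  program : State → Option Bool → Work → Θ → OracleMachine.Action State Work Λ

namespace OracleMachine

attribute [instance] OracleMachine.stateFintype OracleMachine.workFintype
  OracleMachine.workInhabited

variable {Θ Λ : Type*}

/-- A configuration of an oracle machine. -/
structure Config (M : OracleMachine Θ Λ) where
  state : M.State
  /-- the part of the input word from the head of the input tape on -/
  input : List Bool
  work : Turing.Tape M.Work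
  /-- the position of the head on the oracle tape -/
  oraclePos : ℕ
  /-- the word written on the output tape so far -/
  output : List Λ

/-- The start configuration with input word `u`. -/
def init (M : OracleMachine Θ Λ) (u : List Bool) : M.Config where
  state := M.start
  input := u
  work := default
  oraclePos := 0
  output := []

/-- One step of the computation with oracle `α`; nothing changes once a stop state is reached. -/
def step (M : OracleMachine Θ Λ) (α : ℕ → Θ) (c : M.Config) : M.Config :=
  if M.isStop c.state then c
  else
    let a := M.program c.state c.input.head? c.work.head (α c.oraclePos)
    { state := a.next
      input := if a.inputMove then c.input.tail else c.input
      work := a.workMove.elim (c.work.write a.write) fun d => (c.work.write a.write).move d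
      oraclePos := if a.oracleMove then c.oraclePos + 1 else c.oraclePos
      output := c.output ++ a.print.toList }

/-- `M.Outputs α u v`: provided with the oracle `α`, the machine `M` terminates on the input `u`,
and its output is `v`. -/
def Outputs (M : OracleMachine Θ Λ) (α : ℕ → Θ) (u : List Bool) (v : List Λ) : Prop :=
  ∃ n : ℕ, M.isStop ((M.step α)^[n] (M.init u)).state = true ∧
    ((M.step α)^[n] (M.init u)).output = v

/-- The set of inputs on which `M` terminates when provided with the oracle `α`. -/
def dom (M : OracleMachine Θ Λ) (α : ℕ → Θ) : Set (List Bool) :=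
  {u | ∃ v, M.Outputs α u v}

/-- `M` is prefix free: for every oracle its domain is a prefix free set of words. -/
def PrefixFree (M : OracleMachine Θ Λ) : Prop :=
  ∀ α : ℕ → Θ, ∀ u ∈ M.dom α, ∀ u' ∈ M.dom α, u <+: u' → u = u'

/-- `U` simulates `M`: for some word `w`, and all oracles and inputs `u`, `U` terminates on `w u`
iff `M` terminates on `u`, with the same output. -/
def Simulates (U M : OracleMachine Θ Λ) : Prop :=
  ∃ w : List Bool, ∀ (α : ℕ → Θ) (u : List Bool) (v : List Λ),
    U.Outputs α (w ++ u) v ↔ M.Outputs α u v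

/-- Universal oracle machines. -/
def IsUniversal (U : OracleMachine Θ Λ) : Prop :=
  ∀ M : OracleMachine Θ Λ, U.Simulates M

/-- Universal prefix free oracle machines. -/
def IsUniversalPrefixFree (U : OracleMachine Θ Λ) : Prop :=
  U.PrefixFree ∧ ∀ M : OracleMachine Θ Λ, M.PrefixFree → U.Simulates M

/-- The conditional complexity of the word `v` with respect to `M` relative to the oracle `α`
(`⊤` if `v` has no description). -/
noncomputable def condComplexity (M : OracleMachine Θ Λ) (v : List Λ) (α : ℕ → Θ) : ℕ∞ :=
  ⨅ (u : List Bool) (_ : M.Outputs α u v), (u.length : ℕ∞)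

/-- The upper conditional algorithmic complexity of the sequence `ω` relative to `α`, computed
with the machine `U`. -/
noncomputable def upperComplexity (U : OracleMachine Θ Λ) (ω : ℕ → Λ) (α : ℕ → Θ) : ℝ≥0∞ :=
  limsup (fun n : ℕ => (U.condComplexity ((List.range n).map ω) α : ℝ≥0∞) / n) atTop

/-- The lower conditional algorithmic complexity of the sequence `ω` relative to `α`, computed
with the machine `U`. -/
noncomputable def lowerComplexity (U : OracleMachine Θ Λ) (ω : ℕ → Λ) (α : ℕ → Θ) : ℝ≥0∞ :=
  liminf (fun n : ℕ => (U.condComplexity ((List.range n).map ω) α : ℝ≥0∞) / n) atTop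

end OracleMachine

namespace BundleRDS

variable {Θ X ι : Type*}

/-- The shift map on the space of sequences over `Θ`. -/
def shift (α : ℕ → Θ) : ℕ → Θ := fun n => α (n + 1)

/-- The step skew product `(α, x) ↦ (shift α, T_{α₀} x)`. -/
def skewProduct (T : Θ → X → X) (p : (ℕ → Θ) × X) : (ℕ → Θ) × X :=
  (shift p.1, T (p.1 0) p.2)

/-- The composition `T_{α_{n-1}} ∘ ⋯ ∘ T_{α₀}` along `α`. -/
def fiberMap (T : Θ → X → X) (α : ℕ → Θ) : ℕ → X → X
  | 0 => id
  | n + 1 => T (α n) ∘ fiberMap T α n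

/-- `ω` is a name of `x` along `α` with respect to the family of sets `P`. -/
def IsName (T : Θ → X → X) (P : ι → Set X) (α : ℕ → Θ) (x : X) (ω : ℕ → ι) : Prop :=
  ∀ n : ℕ, fiberMap T α n x ∈ P (ω n)

/-- A finite partition of the probability space `(X, μ)`: finitely many (`ι` is meant to be finite)
measurable sets of positive measure that are a.s. disjoint and cover `X` up to a null set. -/
structure IsPartition [MeasurableSpace X] (μ : Measure X) (P : ι → Set X) : Prop where
  measurableSet : ∀ i, MeasurableSet (P i)
  pos : ∀ i, 0 < μ (P i)
  aedisjoint : Pairwise fun i j => AEDisjoint μ (P i) (P j)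
  cover : ∀ᵐ x ∂μ, ∃ i, x ∈ P i

/-- The Shannon entropy, with binary logarithm, of a finite family of sets. -/
noncomputable def shannonEntropy {κ : Type*} [Fintype κ] [MeasurableSpace X] (μ : Measure X)
    (Q : κ → Set X) : ℝ :=
  -∑ k, μ.real (Q k) * Real.logb 2 (μ.real (Q k))

/-- The common refinement of the preimages of `P` under the first `n` maps `fiberMap T α i`, `i < n`,
indexed by the words of length `n`. -/
def refinement (T : Θ → X → X) (P : ι → Set X) (α : ℕ → Θ) (n : ℕ) : (Fin n → ι) → Set X :=
  fun v => ⋂ i : Fin n, fiberMap T α i ⁻¹' P (v i)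

variable [MeasurableSpace Θ] [MeasurableSpace X] [Fintype ι]

/-- The entropy of the `n`-th refinement, averaged over `α`. -/
noncomputable def averagedEntropy (ν : Measure (ℕ → Θ)) (μ : Measure X) (T : Θ → X → X)
    (P : ι → Set X) (n : ℕ) : ℝ :=
  ∫ α, shannonEntropy μ (refinement T P α n) ∂ν

/-- The fiber entropy of the skew product with respect to `P`. -/
noncomputable def fiberEntropy (ν : Measure (ℕ → Θ)) (μ : Measure X) (T : Θ → X → X)
    (P : ι → Set X) : ℝ :=
  limUnder atTop fun n : ℕ => averagedEntropy ν μ T P n / n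

end BundleRDS

section Covering

variable {Ω : Type*}

/-- If, outside of `B`, some block of length at most `L` costs at most `c` per unit of time, and
single steps cost at most `K`, then `φ` grows at rate `c` up to the visits to `B`. -/
theorem le_of_block_cost (S : Ω → Ω) (φ : ℕ → Ω → ℝ) (B : Set Ω) (c K : ℝ) (hcK : c ≤ K) (L : ℕ)
    (p : Ω) (h0 : ∀ k, φ 0 (S^[k] p) ≤ 0)
    (h1 : ∀ k n, φ (n + 1) (S^[k] p) ≤ K + φ n (S^[k + 1] p))
    (h2 : ∀ k, S^[k] p ∉ B → ∃ l, 1 ≤ l ∧ l ≤ L ∧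
      ∀ n, φ (n + l) (S^[k] p) ≤ c * l + φ n (S^[k + l] p)) (n k : ℕ) :
    φ n (S^[k] p) ≤
      c * n + (K - c) * (∑ i ∈ Finset.range n, B.indicator 1 (S^[k + i] p) + L) := by
  have hK : 0 ≤ K - c := by linarith
  have hind : ∀ x : Ω, (0 : ℝ) ≤ B.indicator 1 x := fun x =>
    Set.indicator_nonneg (fun _ _ => zero_le_one) x
  have hshort : ∀ n k, φ n (S^[k] p) ≤ K * n := by
    intro n
    induction n with
    | zero => intro k; simpa using h0 k
    | succ n ih =>
      intro k
      have := h1 k n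
      have := ih (k + 1)
      push_cast
      linarith
  induction n using Nat.strong_induction_on generalizing k with
  | _ n ih =>
    have hsum : ∀ n k, (0 : ℝ) ≤ ∑ i ∈ Finset.range n, B.indicator 1 (S^[k + i] p) :=
      fun n k => Finset.sum_nonneg fun i _ => hind _
    rcases le_or_gt n L with hn | hn
    · have h3 : (n : ℝ) ≤ L := by exact_mod_cast hn
      nlinarith [hshort n k, mul_nonneg hK (hsum n k), mul_le_mul_of_nonneg_left h3 hK]
    · by_cases hB : S^[k] p ∈ B
      · obtain ⟨n, rfl⟩ : ∃ m, n = m + 1 := ⟨n - 1, by omega⟩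
        have h3 := ih n (by omega) (k + 1)
        have h4 := h1 k n
        rw [Finset.sum_range_succ']
        have h5 : B.indicator (1 : Ω → ℝ) (S^[k + 0] p) = 1 := by simp [hB]
        rw [h5]
        have h6 : ∀ i, k + 1 + i = k + (i + 1) := fun i => by omega
        simp only [h6] at h3
        push_cast
        linarith
      · obtain ⟨l, hl1, hlL, hl⟩ := h2 k hB
        obtain ⟨m, rfl⟩ : ∃ m, n = m + l := ⟨n - l, by omega⟩
        have h3 := ih m (by omega) (k + l)
        have h4 := hl m
        have h5 : ∑ i ∈ Finset.range m, B.indicator (1 : Ω → ℝ) (S^[k + l + i] p) ≤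
            ∑ i ∈ Finset.range (m + l), B.indicator 1 (S^[k + i] p) := by
          rw [add_comm m l, Finset.sum_range_add]
          have := hsum l k
          simp only [add_assoc] at *
          linarith
        have h6 := mul_le_mul_of_nonneg_left h5 hK
        push_cast
        linarith

variable [MeasurableSpace Ω] {P : Measure Ω}

theorem MeasureTheory.MeasurePreserving.ae_iterate {S : Ω → Ω} (hS : MeasurePreserving S P P)
    {A : Ω → Prop} (hA : ∀ᵐ p ∂P, A p) : ∀ᵐ p ∂P, ∀ k, A (S^[k] p) :=
  ae_all_iff.2 fun k => (hS.iterate k).quasiMeasurePreserving.ae hA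

theorem MeasureTheory.MeasurePreserving.integral_iterate {S : Ω → Ω} (hS : MeasurePreserving S P P)
    {f : Ω → ℝ} (hf : AEStronglyMeasurable f P) (k : ℕ) :
    ∫ p, f (S^[k] p) ∂P = ∫ p, f p ∂P := by
  have h := hS.iterate k
  rw [← h.map_eq] at hf
  rw [← integral_map h.measurable.aemeasurable hf, h.map_eq]

/-- The a.e. lower growth rate of `ψ` is at least the lower growth rate `h` of the integrals of
functions that are subadditive along blocks with costs `ψ`. -/
theorem ae_eventually_lt_of_block_cost [IsProbabilityMeasure P] {S : Ω → Ω} (hS : Ergodic S P)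
    (ψ : ℕ → Ω → ℝ) (hψ : ∀ l, Measurable (ψ l)) (M : ℝ)
    (hM : ∀ᵐ p ∂P, ∀ l, ψ l (S p) ≤ ψ (l + 1) p + M) (h : ℝ)
    (H : ∀ ε > 0, ∃ (m : ℕ) (K : ℝ) (φ : ℕ → Ω → ℝ), (∀ n, Integrable (φ n) P) ∧
      (∀ n : ℕ, n * h ≤ ∫ p, φ n p ∂P) ∧ ∀ᵐ p ∂P, φ 0 p ≤ 0 ∧ (∀ n, φ (n + 1) p ≤ K + φ n (S p)) ∧
        ∀ l ≥ m, ∀ n, φ (n + l) p ≤ ψ l p + ε * l + φ n (S^[l] p))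
    (c : ℝ) (hc : c < h) : ∀ᵐ p ∂P, ∀ᶠ l : ℕ in atTop, c * l < ψ l p := by
  set D : Set Ω := {p | ∃ R : ℕ, ∀ m : ℕ, ∃ l ≥ m, ψ l p ≤ c * l + R} with hD
  have hDm : MeasurableSet D := by
    have : D = ⋃ R : ℕ, ⋂ m : ℕ, ⋃ l : ℕ, ⋃ _ : l ≥ m, {p | ψ l p ≤ c * l + R} := by
      ext p; simp [hD]
    rw [this]
    exact .iUnion fun R => .iInter fun m => .iUnion fun l => .iUnion fun _ =>
      measurableSet_le (hψ l) measurable_const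
  have hDS : D ≤ᵐ[P] S ⁻¹' D := by
    filter_upwards [hM] with p hp hpD
    obtain ⟨R, hR⟩ := hpD
    obtain ⟨R', hR'⟩ := exists_nat_ge (R + c + M)
    refine ⟨R', fun m => ?_⟩
    obtain ⟨l, hl, hl'⟩ := hR (m + 1)
    obtain ⟨l, rfl⟩ : ∃ k, l = k + 1 := ⟨l - 1, by omega⟩
    refine ⟨l, by omega, ?_⟩
    have := hp l
    push_cast at hl'
    linarith
  rcases hS.ae_empty_or_univ_of_ae_le_preimage hDm.nullMeasurableSet hDS
    with h0 | h1
  · have : ∀ᵐ p ∂P, p ∉ D := by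
      rw [ae_iff]
      simpa using ae_eq_empty.1 h0
    filter_upwards [this] with p hp
    simp only [hD, Set.mem_ofPred_eq, not_exists, not_forall, not_and, not_le] at hp
    obtain ⟨m, hm⟩ := hp 0
    filter_upwards [eventually_ge_atTop m] with l hl
    simpa using hm l hl
  exfalso
  have h1' : ∀ᵐ p ∂P, p ∈ D := by
    filter_upwards [h1] with p hp
    exact cast hp.symm trivial
  set ε := (h - c) / 4 with hε
  have hεpos : 0 < ε := by rw [hε]; linarith
  obtain ⟨m, K, φ, hφi, hφh, hφ⟩ := H ε hεpos
  set c' := c + 2 * ε with hc'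
  set K' := max K c' with hK'
  have hcK : c' ≤ K' := le_max_right _ _
  set B : ℕ → Set Ω := fun L => {p | ∀ l, max m 1 ≤ l → l ≤ L → (c + ε) * l < ψ l p} with hB
  have hBm : ∀ L, MeasurableSet (B L) := by
    intro L
    have : B L = ⋂ l : ℕ, ⋂ _ : max m 1 ≤ l, ⋂ _ : l ≤ L, {p | (c + ε) * l < ψ l p} := by
      ext p; simp [hB]
    rw [this]
    exact .iInter fun l => .iInter fun _ => .iInter fun _ => measurableSet_lt measurable_const (hψ l)
  have hBanti : Antitone B := fun L L' hLL p hp l h1 h2 => hp l h1 (h2.trans hLL)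
  have hB0 : P (⋂ L, B L) = 0 := by
    refine measure_mono_null (fun p hp hpD => ?_ : _ ⊆ {p | p ∉ D}) (ae_iff.1 h1')
    obtain ⟨R, hR⟩ := hpD
    obtain ⟨N, hN⟩ := exists_nat_ge ((R : ℝ) / ε)
    obtain ⟨l, hl, hl'⟩ := hR (max N (max m 1))
    have h2 := Set.mem_iInter.1 hp l l ((le_max_right _ _).trans hl) le_rfl
    have h3 : (N : ℝ) ≤ l := by exact_mod_cast (le_max_left _ _).trans hl
    have h4 : (R : ℝ) ≤ ε * l := by
      rw [div_le_iff₀ hεpos] at hN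
      nlinarith
    linarith
  have hBlim : Tendsto (fun L => P.real (B L)) atTop (𝓝 0) := by
    have := tendsto_measure_iInter_atTop (μ := P) (s := B) (fun L => (hBm L).nullMeasurableSet) hBanti
      ⟨0, measure_ne_top _ _⟩
    rw [hB0] at this
    have h2 := (ENNReal.tendsto_toReal (by simp : (0 : ℝ≥0∞) ≠ ⊤)).comp this
    rwa [ENNReal.toReal_zero] at h2
  have hlim2 : Tendsto (fun L => (K' - c') * P.real (B L)) atTop (𝓝 0) := by
    simpa using hBlim.const_mul (K' - c')
  obtain ⟨L, hL⟩ := (hlim2.eventually (gt_mem_nhds hεpos)).exists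
  have hpt : ∀ᵐ p ∂P, ∀ n, φ n p ≤ c' * n + (K' - c') *
      (∑ i ∈ Finset.range n, (B L).indicator 1 (S^[i] p) + L) := by
    filter_upwards [hS.toMeasurePreserving.ae_iterate hφ] with p hp n
    have := le_of_block_cost S φ (B L) c' K' hcK L p (fun k => (hp k).1) (fun k n => ?_)
      (fun k hk => ?_) n 0
    · simpa using this
    · have h3 := (hp k).2.1 n
      rw [← Function.iterate_succ_apply' S] at h3
      linarith [le_max_left K c']
    · simp only [hB, Set.mem_ofPred_eq, not_forall, not_lt] at hk
      obtain ⟨l, hl, hlL, hl2⟩ := hk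
      refine ⟨l, (le_max_right _ _).trans hl, hlL, fun n => ?_⟩
      have h3 := (hp k).2.2 l ((le_max_left _ _).trans hl) n
      rw [← Function.iterate_add_apply, add_comm l k] at h3
      rw [hc']
      linarith
  have hmain : ∀ n : ℕ, (n : ℝ) * (h - c' - ε) ≤ (K' - c') * L := by
    intro n
    have hindi : ∀ i, Integrable (fun p => (B L).indicator (1 : Ω → ℝ) (S^[i] p)) P := fun i =>
      (hS.toMeasurePreserving.iterate i).integrable_comp_of_integrable
        ((integrable_const (1 : ℝ)).indicator (hBm L))
    have hindv : ∀ i, ∫ p, (B L).indicator (1 : Ω → ℝ) (S^[i] p) ∂P = P.real (B L) := by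
      intro i
      rw [hS.toMeasurePreserving.integral_iterate
        (measurable_one.indicator (hBm L)).aestronglyMeasurable,
        integral_indicator_one (hBm L)]
    have hs : Integrable (fun p => ∑ i ∈ Finset.range n, (B L).indicator (1 : Ω → ℝ) (S^[i] p)) P :=
      integrable_finsetSum _ fun i _ => hindi i
    have hs' : Integrable (fun p => (K' - c') *
        (∑ i ∈ Finset.range n, (B L).indicator (1 : Ω → ℝ) (S^[i] p) + L)) P :=
      (hs.add (integrable_const _)).const_mul _
    have h3 : ∫ p, φ n p ∂P ≤ ∫ p, (c' * n + (K' - c') *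
        (∑ i ∈ Finset.range n, (B L).indicator 1 (S^[i] p) + L)) ∂P :=
      integral_mono_ae (hφi n) ((integrable_const _).add hs') (hpt.mono fun p hp => hp n)
    have h4 : ∫ p, (c' * n + (K' - c') *
        (∑ i ∈ Finset.range n, (B L).indicator 1 (S^[i] p) + L)) ∂P
        = c' * n + (K' - c') * (n * P.real (B L) + L) := by
      rw [integral_add (integrable_const _) hs', integral_const_mul (K' - c'),
        integral_add hs (integrable_const _), integral_finsetSum _ fun i _ => hindi i]
      simp [hindv]
    rw [h4] at h3
    have h5 := hφh n
    nlinarith [mul_le_mul_of_nonneg_left hL.le (Nat.cast_nonneg (α := ℝ) n)]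
  have hpos : 0 < h - c' - ε := by rw [hc', hε]; linarith
  obtain ⟨n, hn⟩ := exists_nat_gt ((K' - c') * L / (h - c' - ε))
  rw [div_lt_iff₀ hpos] at hn
  linarith [hmain n]

/-- The upper half of the pointwise ergodic theorem, for bounded functions. -/
theorem Ergodic.ae_eventually_birkhoffSum_lt [IsProbabilityMeasure P] {S : Ω → Ω}
    (hS : Ergodic S P) {f : Ω → ℝ} (hf : Measurable f) {M : ℝ} (hM : ∀ p, |f p| ≤ M) {c : ℝ}
    (hc : ∫ p, f p ∂P < c) : ∀ᵐ p ∂P, ∀ᶠ n : ℕ in atTop, birkhoffSum S f n p < c * n := by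
  have hmeas : ∀ l, Measurable fun p => -birkhoffSum S f l p := fun l =>
    (Finset.measurable_sum _ fun i _ => hf.comp (hS.measurable.iterate i)).neg
  have hint : Integrable f P := Integrable.of_bound hf.aestronglyMeasurable M (.of_forall hM)
  have key := ae_eventually_lt_of_block_cost hS (fun l p => -birkhoffSum S f l p) hmeas M
    (.of_forall fun p l => ?_) (-∫ p, f p ∂P) (fun ε hε => ?_) (-c) (by linarith)
  · filter_upwards [key] with p hp
    filter_upwards [hp] with n hn
    linarith
  · have := birkhoffSum_succ' S f l p
    have := (abs_le.1 (hM p)).2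
    linarith
  · have hi : ∀ i, Integrable (fun p => f (S^[i] p)) P := fun i =>
      (hS.toMeasurePreserving.iterate i).integrable_comp_of_integrable hint
    refine ⟨0, M, fun l p => -birkhoffSum S f l p, fun n => ?_, fun n => ?_, .of_forall fun p => ?_⟩
    · exact (integrable_finsetSum _ fun i _ => hi i).neg
    · have hv : ∀ i, ∫ p, f (S^[i] p) ∂P = ∫ p, f p ∂P :=
        hS.toMeasurePreserving.integral_iterate hf.aestronglyMeasurable
      rw [integral_neg]
      simp only [birkhoffSum]
      rw [integral_finsetSum _ fun i _ => hi i]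
      simp [hv]
    · refine ⟨by simp, fun n => ?_, fun l _ n => ?_⟩
      · have := birkhoffSum_succ' S f n p
        have := (abs_le.1 (hM p)).1
        linarith
      · have := birkhoffSum_add S f l n p
        rw [add_comm n l]
        have : 0 ≤ ε * l := by positivity
        linarith

end Covering

section DependsOn

variable {Θ β : Type*} {g : (ℕ → Θ) → β} {n : ℕ}

theorem DependsOn.exists_eq_comp_restrict [Nonempty β] (hg : DependsOn g (Set.Iio n)) :
    ∃ g' : (Fin n → Θ) → β, g = g' ∘ fun α i => α i := by
  refine (Function.factorsThrough_iff _).1 fun α α' h => hg fun i hi => ?_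
  exact congrFun h ⟨i, hi⟩

theorem DependsOn.finite_range_of_finite [Finite Θ] (hg : DependsOn g (Set.Iio n)) :
    (Set.range g).Finite := by
  cases isEmpty_or_nonempty (ℕ → Θ)
  · exact Set.toFinite _
  have : Nonempty β := ⟨g (Classical.arbitrary _)⟩
  obtain ⟨g', rfl⟩ := hg.exists_eq_comp_restrict
  exact (Set.finite_range g').subset (Set.range_comp_subset_range _ _)

theorem DependsOn.measurable_of_finite [Finite Θ] [MeasurableSpace Θ] [MeasurableSingletonClass Θ]
    [MeasurableSpace β] (hg : DependsOn g (Set.Iio n)) : Measurable g := by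
  cases isEmpty_or_nonempty (ℕ → Θ)
  · exact measurable_of_empty g
  have : Nonempty β := ⟨g (Classical.arbitrary _)⟩
  obtain ⟨g', rfl⟩ := hg.exists_eq_comp_restrict
  exact (measurable_of_finite g').comp (measurable_pi_lambda _ fun i => measurable_pi_apply _)

end DependsOn

theorem sum_ofFn_add {ι M : Type*} [Fintype ι] [AddCommMonoid M] (m n : ℕ) (g : List ι → M) :
    ∑ w : Fin (m + n) → ι, g (List.ofFn w) =
      ∑ u : Fin m → ι, ∑ v : Fin n → ι, g (List.ofFn u ++ List.ofFn v) := by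
  rw [← Fintype.sum_prod_type']
  refine (Fintype.sum_equiv (Fin.appendEquiv m n) _ _ fun x => ?_).symm
  simp [Fin.appendEquiv, List.ofFn_fin_append]

theorem List.exists_ofFn_eq {ι : Type*} {n : ℕ} (v : List ι) (hv : v.length = n) :
    ∃ w : Fin n → ι, List.ofFn w = v := by
  subst hv
  exact ⟨v.get, List.ofFn_get v⟩

namespace BundleRDS

section Combinatorial

variable {Θ X ι : Type*} (T : Θ → X → X) (π : X → ι) (α : ℕ → Θ) (x : X)

theorem shift_iterate_apply (n k : ℕ) : shift^[n] α k = α (k + n) := by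
  induction n generalizing k with
  | zero => rfl
  | succ n ih => rw [Function.iterate_succ_apply', shift, ih]; congr 1; omega

theorem fiberMap_add (m n : ℕ) :
    fiberMap T α (m + n) x = fiberMap T (shift^[m] α) n (fiberMap T α m x) := by
  induction n with
  | zero => rfl
  | succ n ih =>
    rw [← add_assoc, fiberMap, Function.comp_apply, ih, fiberMap, Function.comp_apply,
      shift_iterate_apply, add_comm n m]

theorem skewProduct_iterate (n : ℕ) (p : (ℕ → Θ) × X) :
    (skewProduct T)^[n] p = (shift^[n] p.1, fiberMap T p.1 n p.2) := by
  induction n with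
  | zero => rfl
  | succ n ih =>
    rw [Function.iterate_succ_apply', ih, Function.iterate_succ_apply', skewProduct, fiberMap]
    simp [shift_iterate_apply]

theorem dependsOn_fiberMap (n : ℕ) : DependsOn (fun α => fiberMap T α n) (Set.Iio n) := by
  induction n with
  | zero => intro _ _ _; rfl
  | succ n ih =>
    intro α α' h
    have h1 := ih fun i hi => h i (Nat.lt_succ_of_lt hi)
    have h2 := h n (Nat.lt_succ_self n)
    simp only [fiberMap] at h1 ⊢
    rw [h1, h2]

/-- The first `n` labels along the orbit of `x` over `α`. -/
def itinerary (n : ℕ) : List ι :=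
  (List.range n).map fun i => π (fiberMap T α i x)

theorem itinerary_eq_ofFn (n : ℕ) :
    itinerary T π α x n = List.ofFn fun i : Fin n => π (fiberMap T α i x) := by
  rw [itinerary, List.ofFn_eq_map, ← List.map_coe_finRange_eq_range, List.map_map]
  rfl

@[simp] theorem length_itinerary (n : ℕ) : (itinerary T π α x n).length = n := by
  simp [itinerary]

@[simp] theorem itinerary_zero : itinerary T π α x 0 = [] := rfl

theorem itinerary_add (m n : ℕ) : itinerary T π α x (m + n) =
    itinerary T π α x m ++ itinerary T π (shift^[m] α) (fiberMap T α m x) n := by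
  simp [itinerary, List.range_add, fiberMap_add, Function.comp_def]

theorem itinerary_succ (n : ℕ) : itinerary T π α x (n + 1) =
    π x :: itinerary T π (shift α) (T (α 0) x) n := by
  rw [add_comm, itinerary_add]
  rfl

theorem dependsOn_itinerary (n : ℕ) :
    DependsOn (fun α => itinerary T π α x n) (Set.Iio n) := by
  intro α α' h
  refine List.map_congr_left fun i hi => ?_
  have hi := List.mem_range.1 hi
  have := dependsOn_fiberMap T i fun j (hj : j < i) => h j (hj.trans hi)
  simp only at this
  rw [this]

end Combinatorial

theorem measurePreserving_fiberMap {Θ X : Type*} [MeasurableSpace X] {μ : Measure X}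
    {T : Θ → X → X} (hT : ∀ θ, MeasurePreserving (T θ) μ μ) (α : ℕ → Θ) (n : ℕ) :
    MeasurePreserving (fiberMap T α n) μ μ := by
  induction n with
  | zero => exact MeasurePreserving.id μ
  | succ n ih => exact (hT _).comp ih

/-- The probability, over `α`, that the itinerary starts with `v`. -/
noncomputable def cylProb {Θ X ι : Type*} [MeasurableSpace X] (μ : Measure X) (T : Θ → X → X) (π : X → ι) (α : ℕ → Θ)
    (v : List ι) : ℝ :=
  μ.real {x | itinerary T π α x v.length = v}

section Measurability

variable {Θ X ι : Type*} [Fintype Θ] [MeasurableSpace Θ] [MeasurableSingletonClass Θ]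
  [MeasurableSpace X] [Fintype ι] {T : Θ → X → X} {π : X → ι}

theorem measurable_fiberMap_uncurry (hT : ∀ θ, Measurable (T θ)) (n : ℕ) :
    Measurable fun p : (ℕ → Θ) × X => fiberMap T p.1 n p.2 := by
  induction n with
  | zero => exact measurable_snd
  | succ n ih =>
    have h1 : Measurable fun q : Θ × X => T q.1 q.2 := measurable_from_prod_countable_right hT
    have h2 : Measurable fun p : (ℕ → Θ) × X => (p.1 n, fiberMap T p.1 n p.2) :=
      ((measurable_pi_apply n).comp measurable_fst).prodMk ih
    exact h1.comp h2

theorem measurableSet_itinerary_mem (hT : ∀ θ, Measurable (T θ))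
    (hπ : ∀ i, MeasurableSet (π ⁻¹' {i})) (n : ℕ) (A : (ℕ → Θ) → Set (List ι))
    (hA : ∀ v, MeasurableSet {α | v ∈ A α}) :
    MeasurableSet {p : (ℕ → Θ) × X | itinerary T π p.1 p.2 n ∈ A p.1} := by
  have : {p : (ℕ → Θ) × X | itinerary T π p.1 p.2 n ∈ A p.1} =
      ⋃ w : Fin n → ι, ((⋂ i : Fin n, (fun p : (ℕ → Θ) × X => fiberMap T p.1 i p.2) ⁻¹'
        (π ⁻¹' {w i})) ∩ Prod.fst ⁻¹' {α | List.ofFn w ∈ A α}) := by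
    ext p
    simp only [Set.mem_ofPred_eq, Set.mem_iUnion, Set.mem_inter_iff, Set.mem_iInter,
      Set.mem_preimage, Set.mem_singleton_iff]
    constructor
    · intro h
      exact ⟨fun i => π (fiberMap T p.1 i p.2), fun i => rfl, by rwa [← itinerary_eq_ofFn]⟩
    · rintro ⟨w, h1, h2⟩
      rw [itinerary_eq_ofFn]
      simpa [h1] using h2
  rw [this]
  exact .iUnion fun w => (MeasurableSet.iInter fun i =>
    measurable_fiberMap_uncurry hT _ (hπ _)).inter (measurable_fst (hA _))

theorem measurable_comp_itinerary (hT : ∀ θ, Measurable (T θ))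
    (hπ : ∀ i, MeasurableSet (π ⁻¹' {i})) (n : ℕ) {β : Type*} [MeasurableSpace β]
    {g : (ℕ → Θ) → List ι → β} (hg : ∀ v, Measurable fun α => g α v) :
    Measurable fun p : (ℕ → Θ) × X => g p.1 (itinerary T π p.1 p.2 n) := fun s hs =>
  measurableSet_itinerary_mem hT hπ n (fun α => {v | g α v ∈ s}) fun v => hg v hs

theorem measurableSet_itinerary_eq (hT : ∀ θ, Measurable (T θ))
    (hπ : ∀ i, MeasurableSet (π ⁻¹' {i})) (α : ℕ → Θ) (n : ℕ) (v : List ι) :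
    MeasurableSet {x | itinerary T π α x n = v} :=
  measurable_prodMk_left (x := α) (measurableSet_itinerary_mem hT hπ n (fun _ => {v}) fun _ =>
    MeasurableSet.const _)

end Measurability

end BundleRDS

namespace BundleRDS

section CylProb

variable {Θ X ι : Type*} [MeasurableSpace X] {μ : Measure X} {T : Θ → X → X} {π : X → ι}

theorem cylProb_nonneg (α : ℕ → Θ) (v : List ι) : 0 ≤ cylProb μ T π α v := measureReal_nonneg

theorem dependsOn_cylProb (v : List ι) :
    DependsOn (fun α => cylProb μ T π α v) (Set.Iio v.length) := by
  intro α α' h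
  have : ∀ x, itinerary T π α x v.length = itinerary T π α' x v.length := fun x =>
    dependsOn_itinerary T π x v.length h
  simp only [cylProb, this]

theorem dependsOn_neg_logb_cylProb {n : ℕ} (v : List ι) (hv : v.length = n) :
    DependsOn (fun α => -Real.logb 2 (cylProb μ T π α v)) (Set.Iio n) := fun α α' h => by
  subst hv
  have := dependsOn_cylProb (μ := μ) (T := T) (π := π) v h
  simp only at this
  simp only [this]

/-- The information function `-log₂` of the probability of the itinerary of length `n`. -/
noncomputable def info (μ : Measure X) (T : Θ → X → X) (π : X → ι) (n : ℕ)
    (p : (ℕ → Θ) × X) : ℝ :=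
  -Real.logb 2 (cylProb μ T π p.1 (itinerary T π p.1 p.2 n))

variable [IsProbabilityMeasure μ]

theorem cylProb_le_one (α : ℕ → Θ) (v : List ι) : cylProb μ T π α v ≤ 1 := measureReal_le_one

theorem cylProb_nil (α : ℕ → Θ) : cylProb μ T π α [] = 1 := by
  simp [cylProb]

theorem cylProb_append_le_left (α : ℕ → Θ) (u v : List ι) :
    cylProb μ T π α (u ++ v) ≤ cylProb μ T π α u := by
  refine measureReal_mono fun x hx => ?_
  simp only [Set.mem_ofPred_eq, List.length_append, itinerary_add] at hx ⊢
  exact (List.append_inj hx (by simp)).1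

theorem info_nonneg (n : ℕ) (p : (ℕ → Θ) × X) : 0 ≤ info μ T π n p :=
  neg_nonneg.2 (Real.logb_nonpos one_lt_two (cylProb_nonneg _ _) (cylProb_le_one _ _))

variable [Fintype Θ] [MeasurableSpace Θ] [MeasurableSingletonClass Θ] [Fintype ι]

theorem cylProb_append_le_right (hT : ∀ θ, MeasurePreserving (T θ) μ μ)
    (hπ : ∀ i, MeasurableSet (π ⁻¹' {i})) (α : ℕ → Θ) (u v : List ι) :
    cylProb μ T π α (u ++ v) ≤ cylProb μ T π (shift^[u.length] α) v := by
  have h1 := (measurePreserving_fiberMap hT α u.length).measureReal_preimage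
    (measurableSet_itinerary_eq (fun θ => (hT θ).measurable) hπ
      (shift^[u.length] α) v.length v).nullMeasurableSet
  rw [cylProb, cylProb, ← h1]
  refine measureReal_mono fun x hx => ?_
  simp only [Set.mem_ofPred_eq, List.length_append, itinerary_add, Set.mem_preimage] at hx ⊢
  exact (List.append_inj hx (by simp)).2

variable {ν : Measure (ℕ → Θ)} [IsProbabilityMeasure ν]

theorem integral_comp_itinerary (hT : ∀ θ, Measurable (T θ))
    (hπ : ∀ i, MeasurableSet (π ⁻¹' {i})) (α : ℕ → Θ) (n : ℕ) (F : List ι → ℝ) :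
    ∫ x, F (itinerary T π α x n) ∂μ =
      ∑ v : Fin n → ι, cylProb μ T π α (List.ofFn v) * F (List.ofFn v) := by
  have h1 : ∀ x, F (itinerary T π α x n) = ∑ v : Fin n → ι,
      {x | itinerary T π α x n = List.ofFn v}.indicator (fun _ => F (List.ofFn v)) x := by
    intro x
    rw [Finset.sum_eq_single fun i : Fin n => π (fiberMap T α i x)]
    · simp [← itinerary_eq_ofFn]
    · intro v _ hv
      refine Set.indicator_of_notMem (fun h => hv ?_) _
      rw [Set.mem_ofPred_eq, itinerary_eq_ofFn] at h
      exact (List.ofFn_injective h).symm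
    · simp
  have h2 := fun v : Fin n → ι => measurableSet_itinerary_eq hT hπ α n (List.ofFn v)
  simp only [h1]
  rw [integral_finsetSum _ fun v _ => (integrable_const _).indicator (h2 v)]
  refine Finset.sum_congr rfl fun v _ => ?_
  rw [integral_indicator_const _ (h2 v)]
  simp [cylProb]

theorem sum_cylProb (hT : ∀ θ, Measurable (T θ))
    (hπ : ∀ i, MeasurableSet (π ⁻¹' {i})) (α : ℕ → Θ) (n : ℕ) :
    ∑ v : Fin n → ι, cylProb μ T π α (List.ofFn v) = 1 := by
  have := integral_comp_itinerary (μ := μ) hT hπ α n fun _ => 1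
  simpa using this.symm

omit [MeasurableSpace Θ] [MeasurableSingletonClass Θ] [MeasurableSpace X] in
theorem exists_abs_comp_itinerary_le (T : Θ → X → X) (π : X → ι) (n : ℕ) {g : (ℕ → Θ) → List ι → ℝ}
    (hg : ∀ v : List ι, v.length = n → DependsOn (fun α => g α v) (Set.Iio n)) :
    ∃ C, ∀ p : (ℕ → Θ) × X, |g p.1 (itinerary T π p.1 p.2 n)| ≤ C := by
  have h1 : ∀ v : Fin n → ι, ∃ C, ∀ α, |g α (List.ofFn v)| ≤ C := by
    intro v
    obtain ⟨C, hC⟩ := ((hg (List.ofFn v) (by simp)).finite_range_of_finite.image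
      (fun r => |r|)).bddAbove
    exact ⟨C, fun α => hC ⟨_, ⟨α, rfl⟩, rfl⟩⟩
  choose C hC using h1
  obtain ⟨D, hD⟩ := (Set.finite_range C).bddAbove
  refine ⟨D, fun p => ?_⟩
  rw [itinerary_eq_ofFn]
  exact (hC _ _).trans (hD ⟨_, rfl⟩)

theorem measurable_local_comp_itinerary (hT : ∀ θ, Measurable (T θ))
    (hπ : ∀ i, MeasurableSet (π ⁻¹' {i})) (n : ℕ) {g : (ℕ → Θ) → List ι → ℝ}
    (hg : ∀ v : List ι, v.length = n → DependsOn (fun α => g α v) (Set.Iio n)) :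
    Measurable fun p : (ℕ → Θ) × X => g p.1 (itinerary T π p.1 p.2 n) := by
  classical
  have h := measurable_comp_itinerary hT hπ n
    (g := fun α v => if v.length = n then g α v else 0) fun v => ?_
  · simpa using h
  · by_cases hv : v.length = n
    · simpa [hv] using (hg v hv).measurable_of_finite
    · simp [hv]

theorem integrable_comp_itinerary (hT : ∀ θ, Measurable (T θ))
    (hπ : ∀ i, MeasurableSet (π ⁻¹' {i})) (n : ℕ) {g : (ℕ → Θ) → List ι → ℝ}
    (hg : ∀ v : List ι, v.length = n → DependsOn (fun α => g α v) (Set.Iio n)) :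
    Integrable (fun p : (ℕ → Θ) × X => g p.1 (itinerary T π p.1 p.2 n)) (ν.prod μ) := by
  obtain ⟨C, hC⟩ := exists_abs_comp_itinerary_le T π n hg
  exact Integrable.of_bound (measurable_local_comp_itinerary hT hπ n hg).aestronglyMeasurable C
    (.of_forall hC)

theorem integral_prod_comp_itinerary (hT : ∀ θ, Measurable (T θ))
    (hπ : ∀ i, MeasurableSet (π ⁻¹' {i})) (n : ℕ) {g : (ℕ → Θ) → List ι → ℝ}
    (hg : ∀ v : List ι, v.length = n → DependsOn (fun α => g α v) (Set.Iio n)) :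
    ∫ p : (ℕ → Θ) × X, g p.1 (itinerary T π p.1 p.2 n) ∂(ν.prod μ) =
      ∫ α, ∑ v : Fin n → ι, cylProb μ T π α (List.ofFn v) * g α (List.ofFn v) ∂ν := by
  rw [integral_prod _ (integrable_comp_itinerary hT hπ n hg)]
  exact integral_congr_ae (.of_forall fun α => integral_comp_itinerary hT hπ α n (g α))

omit [IsProbabilityMeasure μ] in
theorem measurable_info (hT : ∀ θ, Measurable (T θ)) (hπ : ∀ i, MeasurableSet (π ⁻¹' {i}))
    (n : ℕ) : Measurable (info μ T π n) :=
  measurable_local_comp_itinerary hT hπ n fun v hv => dependsOn_neg_logb_cylProb v hv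

theorem integrable_info (hT : ∀ θ, Measurable (T θ)) (hπ : ∀ i, MeasurableSet (π ⁻¹' {i}))
    (n : ℕ) : Integrable (info μ T π n) (ν.prod μ) :=
  integrable_comp_itinerary hT hπ n fun v hv => dependsOn_neg_logb_cylProb v hv

theorem ae_cylProb_itinerary_pos (hT : ∀ θ, Measurable (T θ))
    (hπ : ∀ i, MeasurableSet (π ⁻¹' {i})) :
    ∀ᵐ p ∂(ν.prod μ), ∀ n, 0 < cylProb μ T π p.1 (itinerary T π p.1 p.2 n) := by
  classical
  refine ae_all_iff.2 fun n => ?_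
  have hg : ∀ v : List ι, v.length = n → DependsOn
      (fun α => if cylProb μ T π α v = 0 then (1 : ℝ) else 0) (Set.Iio n) := by
    intro v hv α α' h
    subst hv
    have := dependsOn_cylProb (μ := μ) (T := T) (π := π) v h
    simp only at this
    simp only [this]
  have h1 := integral_prod_comp_itinerary (ν := ν) (μ := μ) hT hπ n hg
  have h2 : ∀ α, ∑ v : Fin n → ι, cylProb μ T π α (List.ofFn v) *
      (if cylProb μ T π α (List.ofFn v) = 0 then (1 : ℝ) else 0) = 0 := fun α =>
    Finset.sum_eq_zero fun v _ => by split_ifs with h <;> simp [h]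
  simp only [h2, integral_zero] at h1
  rw [integral_eq_zero_iff_of_nonneg (fun p => by positivity)
    (integrable_comp_itinerary hT hπ n hg)] at h1
  filter_upwards [h1] with p hp
  refine (cylProb_nonneg _ _).lt_of_ne' fun h0 => ?_
  simp [h0] at hp

/-- Gibbs' inequality. -/
theorem sum_mul_neg_logb_le {κ : Type*} [Fintype κ] {p q : κ → ℝ} (hp : ∀ k, 0 ≤ p k)
    (hp1 : ∑ k, p k = 1) (hq : ∀ k, 0 ≤ q k) (hq1 : ∑ k, q k ≤ 1) (hpq : ∀ k, 0 < p k → 0 < q k) :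
    ∑ k, p k * -Real.logb 2 (p k) ≤ ∑ k, p k * -Real.logb 2 (q k) := by
  have h : ∀ k, p k * -Real.logb 2 (p k) ≤
      p k * -Real.logb 2 (q k) + (q k - p k) / Real.log 2 := by
    intro k
    have hlog : 0 < Real.log 2 := Real.log_pos one_lt_two
    rcases (hp k).eq_or_lt with h0 | h0
    · rw [← h0]
      have := hq k
      simp only [zero_mul, zero_add, sub_zero]
      positivity
    · have h1 := Real.log_le_sub_one_of_pos (div_pos (hpq k h0) h0)
      rw [Real.log_div (hpq k h0).ne' h0.ne'] at h1
      have h2 : p k * (q k / p k) = q k := by field_simp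
      have h3 : p k * (Real.log (q k) - Real.log (p k)) ≤ q k - p k := by
        nlinarith [mul_le_mul_of_nonneg_left h1 h0.le]
      simp only [Real.logb]
      rw [← sub_nonneg]
      have : p k * -(Real.log (q k) / Real.log 2) + (q k - p k) / Real.log 2 -
          p k * -(Real.log (p k) / Real.log 2) =
          (q k - p k - p k * (Real.log (q k) - Real.log (p k))) / Real.log 2 := by
        field_simp; ring
      rw [this]
      exact div_nonneg (by linarith) hlog.le
  calc _ ≤ ∑ k, (p k * -Real.logb 2 (q k) + (q k - p k) / Real.log 2) :=
        Finset.sum_le_sum fun k _ => h k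
    _ = ∑ k, p k * -Real.logb 2 (q k) + (∑ k, q k - 1) / Real.log 2 := by
        rw [Finset.sum_add_distrib, ← Finset.sum_div, Finset.sum_sub_distrib, hp1]
    _ ≤ _ := by
        have : (∑ k, q k - 1) / Real.log 2 ≤ 0 :=
          div_nonpos_of_nonpos_of_nonneg (by linarith) (Real.log_pos one_lt_two).le
        linarith

theorem integral_info_le (hT : ∀ θ, Measurable (T θ)) (hπ : ∀ i, MeasurableSet (π ⁻¹' {i}))
    (n : ℕ) {q : (ℕ → Θ) → List ι → ℝ}
    (hq : ∀ v : List ι, v.length = n → DependsOn (fun α => q α v) (Set.Iio n))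
    (hq0 : ∀ α v, 0 ≤ q α v) (hq1 : ∀ α, ∑ v : Fin n → ι, q α (List.ofFn v) ≤ 1)
    (hpq : ∀ α v, 0 < cylProb μ T π α v → 0 < q α v) :
    ∫ p, info μ T π n p ∂(ν.prod μ) ≤
      ∫ p : (ℕ → Θ) × X, -Real.logb 2 (q p.1 (itinerary T π p.1 p.2 n)) ∂(ν.prod μ) := by
  have hg1 : ∀ v : List ι, v.length = n →
      DependsOn (fun α => -Real.logb 2 (cylProb μ T π α v)) (Set.Iio n) :=
    fun v hv => dependsOn_neg_logb_cylProb v hv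
  have hg2 : ∀ v : List ι, v.length = n →
      DependsOn (fun α => -Real.logb 2 (q α v)) (Set.Iio n) := fun v hv α α' h => by
    have := hq v hv h
    simp only at this
    simp only [this]
  have h1 := integral_prod_comp_itinerary (ν := ν) (μ := μ) hT hπ n hg1
  have h2 := integral_prod_comp_itinerary (ν := ν) (μ := μ) hT hπ n hg2
  have h3 := (integrable_comp_itinerary (ν := ν) (μ := μ) hT hπ n hg1).integral_prod_left
  have h4 := (integrable_comp_itinerary (ν := ν) (μ := μ) hT hπ n hg2).integral_prod_left
  have h5 := fun α => integral_comp_itinerary (μ := μ) hT hπ α n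
    (fun v => -Real.logb 2 (cylProb μ T π α v))
  have h6 := fun α => integral_comp_itinerary (μ := μ) hT hπ α n (fun v => -Real.logb 2 (q α v))
  simp only [h5] at h3
  simp only [h6] at h4
  simp only [info]
  rw [h1, h2]
  exact integral_mono h3 h4 fun α => sum_mul_neg_logb_le (fun v => cylProb_nonneg _ _)
    (sum_cylProb hT hπ α n) (fun v => hq0 α _) (hq1 α) fun v => hpq α _

theorem neg_logb_mul {a b : ℝ} (ha : 0 < a) (hb : 0 < b) :
    -Real.logb 2 (a * b) = -Real.logb 2 a + -Real.logb 2 b := by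
  rw [Real.logb_mul ha.ne' hb.ne']; ring

theorem integral_info_add_le (hT : ∀ θ, MeasurePreserving (T θ) μ μ)
    (hS : MeasurePreserving (skewProduct T) (ν.prod μ) (ν.prod μ))
    (hπ : ∀ i, MeasurableSet (π ⁻¹' {i})) (m n : ℕ) :
    ∫ p, info μ T π (m + n) p ∂(ν.prod μ) ≤
      ∫ p, info μ T π m p ∂(ν.prod μ) + ∫ p, info μ T π n p ∂(ν.prod μ) := by
  have hTm := fun θ => (hT θ).measurable
  have key := integral_info_le (ν := ν) (μ := μ) hTm hπ (m + n) (q := fun α v =>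
    cylProb μ T π α (v.take m) * cylProb μ T π (shift^[m] α) (v.drop m)) ?_ ?_ ?_ ?_
  · refine key.trans_eq ?_
    rw [← hS.integral_iterate (measurable_info (μ := μ) hTm hπ n).aestronglyMeasurable m,
      ← integral_add (integrable_info hTm hπ m) (by
        exact (hS.iterate m).integrable_comp_of_integrable (integrable_info hTm hπ n))]
    refine integral_congr_ae ?_
    filter_upwards [hS.ae_iterate (ae_cylProb_itinerary_pos (ν := ν) (μ := μ) hTm hπ)] with p hp
    simp only [info]
    have h2 := hp 0 m
    have h3 := hp m n
    rw [skewProduct_iterate] at h3 ⊢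
    rw [itinerary_add, List.take_left' (by simp), List.drop_left' (by simp)]
    exact neg_logb_mul h2 h3
  · intro v hv α α' h
    have h1 := dependsOn_cylProb (μ := μ) (T := T) (π := π) (v.take m) fun i hi =>
      h i (by simp at hi ⊢; omega)
    have h2 := dependsOn_cylProb (μ := μ) (T := T) (π := π) (v.drop m) (x := shift^[m] α)
      (y := shift^[m] α') fun i hi => by
        rw [shift_iterate_apply, shift_iterate_apply]
        exact h _ (by simp at hi ⊢; omega)
    simp only at h1 h2
    simp only [h1, h2]
  · exact fun α v => mul_nonneg (cylProb_nonneg _ _) (cylProb_nonneg _ _)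
  · intro α
    rw [sum_ofFn_add m n fun v =>
      cylProb μ T π α (v.take m) * cylProb μ T π (shift^[m] α) (v.drop m)]
    refine le_of_eq ?_
    simp only [List.take_left' (List.length_ofFn), List.drop_left' (List.length_ofFn)]
    rw [← sum_cylProb (μ := μ) hTm hπ α m]
    refine Finset.sum_congr rfl fun u _ => ?_
    rw [← Finset.mul_sum, sum_cylProb hTm hπ, mul_one]
  · intro α v hv
    have h1 : v.take m ++ v.drop m = v := List.take_append_drop m v
    rcases le_total m v.length with hm | hm
    · refine mul_pos (hv.trans_le ?_) (hv.trans_le ?_)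
      · conv_lhs => rw [← h1]
        exact cylProb_append_le_left _ _ _
      · conv_lhs => rw [← h1]
        refine (cylProb_append_le_right hT hπ _ _ _).trans_eq ?_
        simp [hm]
    · rw [List.take_of_length_le hm, List.drop_of_length_le hm, cylProb_nil, mul_one]
      exact hv

end CylProb

end BundleRDS

namespace BundleRDS

section Renewal

variable {Θ X ι : Type*} [MeasurableSpace X] {μ : Measure X} {T : Θ → X → X} {π : X → ι}
  {η : ℝ} {w : ℕ → ℝ}

/-- The weight of a word as a concatenation of single letters, each of weight `η`, and of blocks,
a block of length `l` being weighted with `w l` and with its probability `cylProb`. -/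
noncomputable def renewalWeight (μ : Measure X) (T : Θ → X → X) (π : X → ι) (η : ℝ) (w : ℕ → ℝ) :
    (ℕ → Θ) → List ι → ℝ
  | _, [] => 1
  | α, a :: t => η * renewalWeight μ T π η w (shift α) t +
      ∑ l ∈ Finset.range (t.length + 1), w (l + 1) * cylProb μ T π α ((a :: t).take (l + 1)) *
        renewalWeight μ T π η w (shift^[l + 1] α) (t.drop l)
termination_by _ v => v.length
decreasing_by all_goals (simp; try omega)

theorem renewalWeight_pos (hη : 0 < η) (hw : ∀ l, 0 ≤ w l) (α : ℕ → Θ) (v : List ι) :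
    0 < renewalWeight μ T π η w α v := by
  induction h : v.length using Nat.strong_induction_on generalizing α v with
  | _ n ih =>
    cases v with
    | nil => simp [renewalWeight]
    | cons a t =>
      rw [renewalWeight]
      refine add_pos_of_pos_of_nonneg (mul_pos hη (ih t.length (by simp [← h]) _ _ rfl))
        (Finset.sum_nonneg fun l _ => ?_)
      exact mul_nonneg (mul_nonneg (hw _) (cylProb_nonneg _ _))
        (ih (t.drop l).length (by simp [← h]) _ _ rfl).le

theorem dependsOn_renewalWeight (v : List ι) :
    DependsOn (fun α => renewalWeight μ T π η w α v) (Set.Iio v.length) := by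
  induction h : v.length using Nat.strong_induction_on generalizing v with
  | _ n ih =>
    intro α α' hα
    subst h
    cases v with
    | nil => simp [renewalWeight]
    | cons a t =>
      simp only [renewalWeight]
      congr 1
      · have := ih t.length (by simp) t rfl (x := shift α) (y := shift α') fun i hi =>
          hα (i + 1) (by simpa using hi)
        simp only at this
        rw [this]
      · refine Finset.sum_congr rfl fun l hl => ?_
        have hl := Finset.mem_range.1 hl
        have h1 := ih (t.drop l).length (by simp) (t.drop l) rfl (x := shift^[l + 1] α)
          (y := shift^[l + 1] α') fun i hi => by
            rw [shift_iterate_apply, shift_iterate_apply]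
            exact hα _ (by simp at hi ⊢; omega)
        have h2 := dependsOn_cylProb (μ := μ) (T := T) (π := π) ((a :: t).take (l + 1))
          fun i hi => hα i (by simp at hi ⊢; omega)
        simp only at h1 h2
        rw [h1, h2]

theorem le_renewalWeight_cons [IsProbabilityMeasure μ] (hη : 0 < η) (hw : ∀ l, 0 ≤ w l)
    (α : ℕ → Θ) (a : ι) (t : List ι) :
    η * renewalWeight μ T π η w (shift α) t ≤ renewalWeight μ T π η w α (a :: t) := by
  rw [renewalWeight]
  refine le_add_of_nonneg_right (Finset.sum_nonneg fun l _ => ?_)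
  exact mul_nonneg (mul_nonneg (hw _) (cylProb_nonneg _ _)) (renewalWeight_pos hη hw _ _).le

theorem le_renewalWeight_append (hη : 0 < η) (hw : ∀ l, 0 ≤ w l)
    (α : ℕ → Θ) (u v : List ι) (hu : 1 ≤ u.length) :
    w u.length * cylProb μ T π α u * renewalWeight μ T π η w (shift^[u.length] α) v ≤
      renewalWeight μ T π η w α (u ++ v) := by
  cases u with
  | nil => simp at hu
  | cons a t =>
    rw [List.cons_append, renewalWeight]
    refine le_add_of_nonneg_of_le (mul_pos hη (renewalWeight_pos hη hw _ _)).le ?_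
    have h := Finset.single_le_sum (f := fun l => w (l + 1) *
      cylProb μ T π α ((a :: (t ++ v)).take (l + 1)) *
        renewalWeight μ T π η w (shift^[l + 1] α) ((t ++ v).drop l)) (fun l _ =>
        mul_nonneg (mul_nonneg (hw _) (cylProb_nonneg _ _)) (renewalWeight_pos hη hw _ _).le)
      (Finset.mem_range.2 (by simp : t.length < (t ++ v).length + 1))
    simpa using h

variable [Fintype Θ] [MeasurableSpace Θ] [MeasurableSingletonClass Θ] [Fintype ι]
  [IsProbabilityMeasure μ]

theorem sum_renewalWeight_le (hT : ∀ θ, Measurable (T θ)) (hπ : ∀ i, MeasurableSet (π ⁻¹' {i}))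
    (hη : 0 < η) (hw : ∀ l, 0 ≤ w l)
    (hηw : ∀ n, Fintype.card ι * η + ∑ l ∈ Finset.range n, w (l + 1) ≤ 1) (n : ℕ) (α : ℕ → Θ) :
    ∑ v : Fin n → ι, renewalWeight μ T π η w α (List.ofFn v) ≤ 1 := by
  induction n using Nat.strong_induction_on generalizing α with
  | _ n ih =>
    cases n with
    | zero => simp [renewalWeight]
    | succ n =>
      have h1 : ∑ v : Fin (n + 1) → ι, η * renewalWeight μ T π η w (shift α) (List.ofFn v).tail ≤
          Fintype.card ι * η := by
        have h2 := sum_ofFn_add 1 n fun v : List ι =>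
          η * renewalWeight μ T π η w (shift α) v.tail
        rw [add_comm 1 n] at h2
        rw [h2]
        have h3 := ih n (by omega) (shift α)
        simp only [List.ofFn_succ, List.ofFn_zero, List.cons_append, List.nil_append,
          List.tail_cons, ← Finset.mul_sum]
        simp only [Finset.sum_const, Finset.card_univ, nsmul_eq_mul]
        simp only [Fintype.card_pi, Finset.prod_const, Finset.card_univ, Fintype.card_fin, pow_one]
        have : (0 : ℝ) ≤ Fintype.card ι * η := by positivity
        nlinarith
      have h2 : ∀ l ∈ Finset.range (n + 1), ∑ v : Fin (n + 1) → ι, w (l + 1) *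
          cylProb μ T π α ((List.ofFn v).take (l + 1)) *
            renewalWeight μ T π η w (shift^[l + 1] α) ((List.ofFn v).drop (l + 1)) ≤ w (l + 1) := by
        intro l hl
        have hl := Finset.mem_range.1 hl
        have h3 := sum_ofFn_add (l + 1) (n - l) fun v : List ι => w (l + 1) *
          cylProb μ T π α (v.take (l + 1)) *
            renewalWeight μ T π η w (shift^[l + 1] α) (v.drop (l + 1))
        rw [show l + 1 + (n - l) = n + 1 by omega] at h3
        rw [h3]
        simp only [List.take_left' (List.length_ofFn), List.drop_left' (List.length_ofFn)]
        have h4 := ih (n - l) (by omega) (shift^[l + 1] α)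
        calc _ ≤ ∑ u : Fin (l + 1) → ι, w (l + 1) * cylProb μ T π α (List.ofFn u) := by
              refine Finset.sum_le_sum fun u _ => ?_
              rw [← Finset.mul_sum]
              exact mul_le_of_le_one_right (mul_nonneg (hw _) (cylProb_nonneg _ _)) h4
          _ = w (l + 1) := by rw [← Finset.mul_sum, sum_cylProb hT hπ, mul_one]
      have h3 : ∀ v : Fin (n + 1) → ι, renewalWeight μ T π η w α (List.ofFn v) =
          η * renewalWeight μ T π η w (shift α) (List.ofFn v).tail +
          ∑ l ∈ Finset.range (n + 1), w (l + 1) *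
            cylProb μ T π α ((List.ofFn v).take (l + 1)) *
              renewalWeight μ T π η w (shift^[l + 1] α) ((List.ofFn v).drop (l + 1)) := by
        intro v
        rw [List.ofFn_succ, renewalWeight]
        simp
      simp only [h3]
      rw [Finset.sum_add_distrib, Finset.sum_comm]
      exact (add_le_add h1 (Finset.sum_le_sum h2)).trans (hηw _)

variable {ν : Measure (ℕ → Θ)} [IsProbabilityMeasure ν]

/-- The lower half of the Shannon-McMillan-Breiman theorem for the fiber entropy. -/
theorem ae_eventually_lt_info [Nonempty ι] (hT : ∀ θ, MeasurePreserving (T θ) μ μ)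
    (hπ : ∀ i, MeasurableSet (π ⁻¹' {i})) (hS : Ergodic (skewProduct T) (ν.prod μ)) {h c : ℝ}
    (hh : ∀ n : ℕ, n * h ≤ ∫ p, info μ T π n p ∂(ν.prod μ)) (hc : c < h) :
    ∀ᵐ p ∂(ν.prod μ), ∀ᶠ n : ℕ in atTop, c * n < info μ T π n p := by
  have hTm := fun θ => (hT θ).measurable
  have hpos := hS.toMeasurePreserving.ae_iterate
    (ae_cylProb_itinerary_pos (ν := ν) (μ := μ) hTm hπ)
  refine ae_eventually_lt_of_block_cost hS (info μ T π) (measurable_info hTm hπ) 0 ?_ h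
    (fun ε hε => ?_) c hc
  · filter_upwards [hpos] with p hp l
    have h1 := hp 0 (l + 1)
    simp only [info, Function.iterate_zero, id_eq, itinerary_succ, skewProduct, add_zero] at h1 ⊢
    rw [neg_le_neg_iff]
    exact Real.logb_le_logb_of_le one_lt_two h1
      (cylProb_append_le_right hT hπ p.1 [π p.2] _)
  · set r : ℝ := 2 ^ (-(ε / 2)) with hr
    have hr0 : 0 < r := by positivity
    have hr1 : r < 1 := Real.rpow_lt_one_of_one_lt_of_neg one_lt_two (by linarith)
    set C : ℝ := (1 - r) / 2 with hC
    have hC0 : 0 < C := by rw [hC]; linarith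
    set w : ℕ → ℝ := fun l => C * r ^ l with hw
    have hw0 : ∀ l, 0 < w l := fun l => by positivity
    set η : ℝ := 1 / (2 * Fintype.card ι) with hη
    have hcard : (0 : ℝ) < Fintype.card ι := by exact_mod_cast Fintype.card_pos
    have hη0 : 0 < η := by positivity
    have hsum : ∀ n, Fintype.card ι * η + ∑ l ∈ Finset.range n, w (l + 1) ≤ 1 := by
      intro n
      have h1 : Fintype.card ι * η = 1 / 2 := by rw [hη]; field_simp
      have h2 : ∑ l ∈ Finset.range n, w (l + 1) =
          r / 2 * ((1 - r) * ∑ l ∈ Finset.range n, r ^ l) := by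
        simp only [hw, hC, Finset.mul_sum]
        exact Finset.sum_congr rfl fun l _ => by ring
      rw [h1, h2, mul_neg_geom_sum]
      have : 0 < r ^ n := by positivity
      nlinarith
    obtain ⟨m, hm⟩ := exists_nat_ge (-Real.logb 2 C / (ε / 2))
    have hlogw : ∀ l, m ≤ l → -Real.logb 2 (w l) ≤ ε * l := by
      intro l hl
      have h1 : Real.logb 2 (r ^ l) = -(ε / 2) * l := by
        rw [Real.logb_pow, hr, Real.logb_rpow two_pos (by norm_num)]; ring
      simp only [hw]
      rw [neg_logb_mul hC0 (by positivity), h1]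
      have h2 : (m : ℝ) ≤ l := by exact_mod_cast hl
      rw [div_le_iff₀ (by positivity)] at hm
      nlinarith
    set q := renewalWeight μ T π η w with hq
    have hqpos := renewalWeight_pos (μ := μ) (T := T) (π := π) hη0 fun l => (hw0 l).le
    refine ⟨max m 1, -Real.logb 2 η, fun n p => -Real.logb 2 (q p.1 (itinerary T π p.1 p.2 n)),
      fun n => ?_, fun n => (hh n).trans ?_, ?_⟩
    · refine integrable_comp_itinerary hTm hπ n (g := fun α v => -Real.logb 2 (q α v))
        fun v hv α α' h => ?_
      subst hv
      have := dependsOn_renewalWeight (μ := μ) (T := T) (π := π) (η := η) (w := w) v h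
      simp only at this
      simp only [hq, this]
    · refine integral_info_le hTm hπ n (fun v hv => ?_) (fun α v => (hqpos α v).le)
        (sum_renewalWeight_le hTm hπ hη0 (fun l => (hw0 l).le) hsum n) fun α v _ => hqpos α v
      subst hv
      exact dependsOn_renewalWeight v
    · filter_upwards [hpos] with p hp
      refine ⟨by simp [hq, renewalWeight], fun n => ?_, fun l hl n => ?_⟩
      · rw [itinerary_succ, ← neg_logb_mul hη0 (hqpos _ _), neg_le_neg_iff]
        exact Real.logb_le_logb_of_le one_lt_two (mul_pos hη0 (hqpos _ _))
          (le_renewalWeight_cons hη0 (fun l => (hw0 l).le) _ _ _)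
      · have h1 := le_renewalWeight_append (μ := μ) (T := T) (π := π) hη0 (fun l => (hw0 l).le) p.1
          (itinerary T π p.1 p.2 l) (itinerary T π (shift^[l] p.1) (fiberMap T p.1 l p.2) n)
          (by simpa using (le_max_right _ _).trans hl)
        rw [length_itinerary, ← itinerary_add] at h1
        have h2 : 0 < cylProb μ T π p.1 (itinerary T π p.1 p.2 l) := hp 0 l
        have h3 := Real.logb_le_logb_of_le one_lt_two
          (mul_pos (mul_pos (hw0 l) h2) (hqpos _ _)) h1
        have h4 := neg_logb_mul (mul_pos (hw0 l) h2) (hqpos (shift^[l] p.1)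
          (itinerary T π (shift^[l] p.1) (fiberMap T p.1 l p.2) n))
        have h5 := neg_logb_mul (hw0 l) h2
        have h6 := hlogw l ((le_max_left _ _).trans hl)
        rw [skewProduct_iterate, add_comm n l]
        simp only [info, hq]
        linarith

end Renewal

end BundleRDS

namespace OracleMachine

/-- The program of an oracle machine without work tape, with states in an arbitrary type. -/
structure Control (σ Θ Λ : Type*) where
  isStop : σ → Bool
  next : σ → Option Bool → Θ → σ
  inputMove : σ → Option Bool → Θ → Bool
  oracleMove : σ → Option Bool → Θ → Bool
  print : σ → Option Bool → Θ → Option Λ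

namespace Control

variable {σ Θ Λ : Type*}

/-- The configurations: state, remaining input, position on the oracle tape, output. -/
structure Cfg (σ Λ : Type*) where
  state : σ
  input : List Bool
  pos : ℕ
  output : List Λ

/-- One step of the computation. -/
def step (C : Control σ Θ Λ) (α : ℕ → Θ) (c : Cfg σ Λ) : Cfg σ Λ :=
  if C.isStop c.state then c
  else
    { state := C.next c.state c.input.head? (α c.pos)
      input := if C.inputMove c.state c.input.head? (α c.pos) then c.input.tail else c.input
      pos := if C.oracleMove c.state c.input.head? (α c.pos) then c.pos + 1 else c.pos
      output := c.output ++ (C.print c.state c.input.head? (α c.pos)).toList }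

theorem exists_oracleMachine (C : Control σ Θ Λ) (F : Set σ) (hF : F.Finite) (q₀ : σ) (hq₀ : q₀ ∈ F)
    (hC : ∀ q ∈ F, ∀ x θ, C.next q x θ ∈ F) :
    ∃ M : OracleMachine Θ Λ, ∀ α u v, M.Outputs α u v ↔
      ∃ n, C.isStop ((C.step α)^[n] ⟨q₀, u, 0, []⟩).state = true ∧
        ((C.step α)^[n] ⟨q₀, u, 0, []⟩).output = v := by
  have : Finite F := hF
  obtain ⟨k, ⟨e⟩⟩ := Finite.exists_equiv_fin F
  let M : OracleMachine Θ Λ :=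
    { State := Fin k
      Work := Unit
      start := e ⟨q₀, hq₀⟩
      isStop := fun q => C.isStop (e.symm q).1
      program := fun q x _ θ =>
        { next := e ⟨C.next (e.symm q).1 x θ, hC _ (e.symm q).2 x θ⟩
          write := ()
          workMove := none
          inputMove := C.inputMove (e.symm q).1 x θ
          oracleMove := C.oracleMove (e.symm q).1 x θ
          print := C.print (e.symm q).1 x θ } }
  let f : M.Config → Cfg σ Λ := fun c => ⟨(e.symm c.state).1, c.input, c.oraclePos, c.output⟩
  have hf : ∀ α, Function.Semiconj f (M.step α) (C.step α) := by
    intro α c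
    simp only [f, OracleMachine.step, Control.step]
    by_cases h : C.isStop (e.symm c.state).1 = true
    · simp [M, h]
    · simp [M, h]
  refine ⟨M, fun α u v => ?_⟩
  have hinit : f (M.init u) = ⟨q₀, u, 0, []⟩ := by simp [f, M, OracleMachine.init]
  have h := fun n => ((hf α).iterate_right n).eq (M.init u)
  rw [hinit] at h
  simp only [OracleMachine.Outputs, ← h]
  rfl

variable (C : Control σ Θ Λ) (α : ℕ → Θ)

/-- `c'` is reached from `c`. -/
def Reaches (c c' : Cfg σ Λ) : Prop := ∃ n, (C.step α)^[n] c = c'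

variable {C α}

theorem Reaches.refl (c : Cfg σ Λ) : C.Reaches α c c := ⟨0, rfl⟩

theorem Reaches.trans {c c' c'' : Cfg σ Λ} (h : C.Reaches α c c') (h' : C.Reaches α c' c'') :
    C.Reaches α c c'' := by
  obtain ⟨m, rfl⟩ := h
  obtain ⟨n, rfl⟩ := h'
  exact ⟨n + m, Function.iterate_add_apply _ _ _ _⟩

theorem Reaches.head {c c' : Cfg σ Λ} (h : C.Reaches α (C.step α c) c') : C.Reaches α c c' :=
  Reaches.trans ⟨1, rfl⟩ h

end Control

/-- The states of a decoder of block codes. -/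
inductive DecoderState (Θ Λ : Type*)
  /-- print the given word and move along the oracle -/
  | skip (r : List Λ)
  /-- read the next block of the oracle, of which a part has been read -/
  | read (a : List Θ)
  /-- read a code word, of which a part has been read -/
  | decode (a : List Θ) (b : List Bool)
  /-- print the given block -/
  | emit (r : List Λ)
  /-- print the given word and halt at the end of the input -/
  | finish (r : List Λ)
  | halt

namespace DecoderState

/-- The control of a decoder for a table `D` (`some none` is the end of the message), for blocks of
length `N` and code words of length at most `L`, that ends its output with `t`. -/
def control {Θ Λ : Type*} (N L : ℕ) (D : List Θ → List Bool → Option (Option (List Λ)))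
    (t : List Λ) : Control (DecoderState Θ Λ) Θ Λ where
  isStop
    | halt => true
    | _ => false
  next
    | skip [], _, _ => read []
    | skip (_ :: r), _, _ => skip r
    | read a, _, θ => if a.length < N then read (a ++ [θ]) else decode a []
    | decode a b, x, _ =>
      match D a b with
      | some (some r) => emit r
      | some none => finish t
      | none => x.elim (decode a b) fun x => if b.length < L then decode a (b ++ [x]) else decode a b
    | emit [], _, _ => read []
    | emit (_ :: r), _, _ => emit r
    | finish (_ :: r), _, _ => finish r
    | finish [], none, _ => halt
    | finish [], some _, _ => finish []
    | halt, _, _ => halt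
  inputMove
    | decode a b, _, _ => (D a b).isNone && decide (b.length < L)
    | _, _, _ => false
  oracleMove
    | skip (_ :: _), _, _ => true
    | read a, _, _ => decide (a.length < N)
    | _, _, _ => false
  print
    | skip (x :: _), _, _ => some x
    | emit (x :: _), _, _ => some x
    | finish (x :: _), _, _ => some x
    | _, _, _ => none

variable {Θ Λ : Type*} {N L : ℕ} {D : List Θ → List Bool → Option (Option (List Λ))} {t : List Λ}
  {α : ℕ → Θ}

open Control

section Step

variable (r : List Λ) (x : Λ) (a : List Θ) (b u : List Bool) (y : Bool) (k : ℕ) (o : List Λ)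

theorem step_skip_nil : (control N L D t).step α ⟨skip [], u, k, o⟩ = ⟨read [], u, k, o⟩ := by
  simp [control, Control.step]

theorem step_skip_cons : (control N L D t).step α ⟨skip (x :: r), u, k, o⟩ =
    ⟨skip r, u, k + 1, o ++ [x]⟩ := by
  simp [control, Control.step]

theorem step_read (h : a.length < N) : (control N L D t).step α ⟨read a, u, k, o⟩ =
    ⟨read (a ++ [α k]), u, k + 1, o⟩ := by
  simp [control, Control.step, h]

theorem step_read_of_le (h : N ≤ a.length) : (control N L D t).step α ⟨read a, u, k, o⟩ =
    ⟨decode a [], u, k, o⟩ := by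
  simp [control, Control.step, h.not_gt]

theorem step_decode_some (m : Option (List Λ)) (h : D a b = some m) :
    (control N L D t).step α ⟨decode a b, u, k, o⟩ = ⟨m.elim (finish t) emit, u, k, o⟩ := by
  cases m <;> simp [control, Control.step, h]

theorem step_decode_cons (h : D a b = none) (hb : b.length < L) :
    (control N L D t).step α ⟨decode a b, y :: u, k, o⟩ = ⟨decode a (b ++ [y]), u, k, o⟩ := by
  simp [control, Control.step, h, hb]

theorem step_decode_nil (h : D a b = none) :
    (control N L D t).step α ⟨decode a b, [], k, o⟩ = ⟨decode a b, [], k, o⟩ := by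
  simp [control, Control.step, h]

theorem step_decode_of_le (h : D a b = none) (hb : L ≤ b.length) :
    (control N L D t).step α ⟨decode a b, u, k, o⟩ = ⟨decode a b, u, k, o⟩ := by
  cases u <;> simp [control, Control.step, h, hb.not_gt]

theorem step_emit_nil : (control N L D t).step α ⟨emit [], u, k, o⟩ = ⟨read [], u, k, o⟩ := by
  simp [control, Control.step]

theorem step_emit_cons : (control N L D t).step α ⟨emit (x :: r), u, k, o⟩ =
    ⟨emit r, u, k, o ++ [x]⟩ := by
  simp [control, Control.step]

theorem step_finish_cons : (control N L D t).step α ⟨finish (x :: r), u, k, o⟩ =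
    ⟨finish r, u, k, o ++ [x]⟩ := by
  simp [control, Control.step]

theorem step_finish_nil_nil : (control N L D t).step α ⟨finish [], [], k, o⟩ =
    ⟨halt, [], k, o⟩ := by
  simp [control, Control.step]

theorem step_finish_nil_cons : (control N L D t).step α ⟨finish [], y :: u, k, o⟩ =
    ⟨finish [], y :: u, k, o⟩ := by
  simp [control, Control.step]

end Step

theorem reaches_skip (r : List Λ) (u : List Bool) (k : ℕ) (o : List Λ) :
    (control N L D t).Reaches α ⟨skip r, u, k, o⟩ ⟨read [], u, k + r.length, o ++ r⟩ := by
  induction r generalizing k o with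
  | nil => exact Reaches.head (by simpa [step_skip_nil] using Reaches.refl _)
  | cons x r ih =>
    refine Reaches.head ?_
    have := ih (k + 1) (o ++ [x])
    simpa [step_skip_cons, add_comm, add_left_comm] using this

theorem reaches_emit (r : List Λ) (u : List Bool) (k : ℕ) (o : List Λ) :
    (control N L D t).Reaches α ⟨emit r, u, k, o⟩ ⟨read [], u, k, o ++ r⟩ := by
  induction r generalizing o with
  | nil => exact Reaches.head (by simpa [step_emit_nil] using Reaches.refl _)
  | cons x r ih =>
    refine Reaches.head ?_
    have := ih (o ++ [x])
    simpa [step_emit_cons] using this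

theorem reaches_finish (r : List Λ) (k : ℕ) (o : List Λ) :
    (control N L D t).Reaches α ⟨finish r, [], k, o⟩ ⟨halt, [], k, o ++ r⟩ := by
  induction r generalizing o with
  | nil => exact Reaches.head (by simpa [step_finish_nil_nil] using Reaches.refl _)
  | cons x r ih =>
    refine Reaches.head ?_
    have := ih (o ++ [x])
    simpa [step_finish_cons] using this

theorem reaches_read (j : ℕ) (a : List Θ) (u : List Bool) (k : ℕ) (o : List Λ)
    (hj : a.length + j = N) : (control N L D t).Reaches α ⟨read a, u, k, o⟩
      ⟨decode (a ++ List.ofFn fun i : Fin j => α (k + i)) [], u, k + j, o⟩ := by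
  induction j generalizing a k with
  | zero =>
    refine Reaches.head ?_
    rw [step_read_of_le _ _ _ _ (by omega)]
    simpa using Reaches.refl _
  | succ j ih =>
    refine Reaches.head ?_
    rw [step_read _ _ _ _ (by omega)]
    have := ih (a ++ [α k]) (k + 1) (by simp; omega)
    simpa [List.ofFn_succ, add_comm, add_left_comm] using this

theorem reaches_decode (a : List Θ) (b b' : List Bool) (u : List Bool) (k : ℕ) (o : List Λ)
    (hL : (b ++ b').length ≤ L) (hD : ∀ b'', b'' <+: b ++ b' → b'' ≠ b ++ b' → D a b'' = none) :
    (control N L D t).Reaches α ⟨decode a b, b' ++ u, k, o⟩ ⟨decode a (b ++ b'), u, k, o⟩ := by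
  induction b' generalizing b with
  | nil => simpa using Reaches.refl _
  | cons x b' ih =>
    refine Reaches.head ?_
    have h : b.length < L := by simp at hL; omega
    have h1 : D a b = none := hD b (List.prefix_append _ _) (by simp)
    have := ih (b ++ [x]) (by simpa using hL) (by simpa using hD)
    rw [List.cons_append, step_decode_cons _ _ _ _ _ _ h1 h]
    simpa using this

/-- The code of the letters `ω k, ω (k + 1), …` in `K` blocks of length `N`. -/
def encode (N : ℕ) (c : List Θ → Option (Fin N → Λ) → List Bool) (α : ℕ → Θ) (ω : ℕ → Λ) :
    ℕ → ℕ → List Bool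
  | k, 0 => c (List.ofFn fun i : Fin N => α (k + i)) none
  | k, K + 1 => c (List.ofFn fun i : Fin N => α (k + i)) (some fun i => ω (k + i)) ++
      encode N c α ω (k + N) K

open Classical in
/-- The decoding table of a block code. -/
noncomputable def table (N : ℕ) (c : List Θ → Option (Fin N → Λ) → List Bool) (a : List Θ)
    (b : List Bool) : Option (Option (List Λ)) :=
  if h : ∃ m, c a m = b then some (h.choose.map List.ofFn) else none

section Table

variable {c : List Θ → Option (Fin N → Λ) → List Bool}

theorem table_code (hc : ∀ a m m', c a m <+: c a m' → m = m') (a : List Θ)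
    (m : Option (Fin N → Λ)) : table N c a (c a m) = some (m.map List.ofFn) := by
  have h : ∃ m', c a m' = c a m := ⟨m, rfl⟩
  have h' : h.choose = m := hc a _ _ (by simp [h.choose_spec])
  rw [table, dif_pos h, h']

theorem table_of_prefix (hc : ∀ a m m', c a m <+: c a m' → m = m') (a : List Θ)
    (m : Option (Fin N → Λ)) (b : List Bool) (hb : b <+: c a m) (hne : b ≠ c a m) :
    table N c a b = none := by
  rw [table, dif_neg]
  rintro ⟨m', rfl⟩
  exact hne (by rw [hc a _ _ hb])

theorem reaches_block (hc : ∀ a m m', c a m <+: c a m' → m = m')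
    (hL : ∀ a : List Θ, a.length = N → ∀ m, (c a m).length ≤ L) (m : Option (Fin N → Λ))
    (u : List Bool) (k : ℕ) (o : List Λ) :
    (control N L (table N c) t).Reaches α
      ⟨read [], c (List.ofFn fun i : Fin N => α (k + i)) m ++ u, k, o⟩
      ⟨m.elim (finish t) fun r => emit (List.ofFn r), u, k + N, o⟩ := by
  set a := List.ofFn fun i : Fin N => α (k + i) with ha
  refine (reaches_read N [] _ k o (by simp)).trans ?_
  rw [List.nil_append, ← ha]
  refine (reaches_decode a [] (c a m) u _ o (by simpa using hL a (by simp [ha]) m)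
    fun b h1 h2 => table_of_prefix hc a m b (by simpa using h1) (by simpa using h2)).trans ?_
  refine Reaches.head ?_
  rw [List.nil_append, step_decode_some _ _ _ _ _ _ (table_code hc a m)]
  cases m <;> exact Reaches.refl _

theorem reaches_encode (hc : ∀ a m m', c a m <+: c a m' → m = m')
    (hL : ∀ a : List Θ, a.length = N → ∀ m, (c a m).length ≤ L) (ω : ℕ → Λ) (K k : ℕ)
    (o : List Λ) : ∃ k', (control N L (table N c) t).Reaches α
      ⟨read [], encode N c α ω k K, k, o⟩
      ⟨halt, [], k', o ++ ((List.range (K * N)).map fun i => ω (k + i)) ++ t⟩ := by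
  induction K generalizing k o with
  | zero =>
    have h := reaches_block (t := t) (α := α) hc hL none [] k o
    rw [List.append_nil] at h
    exact ⟨_, h.trans (by simpa using reaches_finish t _ o)⟩
  | succ K ih =>
    have h := reaches_block (t := t) (α := α) hc hL (some fun i => ω (k + i))
      (encode N c α ω (k + N) K) k o
    obtain ⟨k', hk'⟩ := ih (k + N) (o ++ List.ofFn fun i : Fin N => ω (k + i))
    refine ⟨k', h.trans ((reaches_emit _ _ _ _).trans ?_)⟩
    convert hk' using 2
    rw [Nat.succ_mul, add_comm (K * N) N, List.range_add, List.map_append, List.map_map,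
      List.ofFn_eq_map, ← List.map_coe_finRange_eq_range, List.map_map]
    simp [Function.comp_def, add_assoc]

end Table

/-- The finite set of states that the decoder uses. -/
def bounded (Θ Λ : Type*) (N L R : ℕ) : Set (DecoderState Θ Λ) :=
  skip '' {r | r.length ≤ R} ∪ read '' {a | a.length ≤ N} ∪
    (fun p : List Θ × List Bool => decode p.1 p.2) '' ({a | a.length ≤ N} ×ˢ {b | b.length ≤ L}) ∪
    emit '' {r | r.length ≤ R} ∪ finish '' {r | r.length ≤ R} ∪ {halt}

theorem finite_bounded [Finite Θ] [Finite Λ] (N L R : ℕ) : (bounded Θ Λ N L R).Finite := by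
  have h1 := List.finite_length_le Λ R
  have h2 := List.finite_length_le Θ N
  have h3 := List.finite_length_le Bool L
  exact (((((h1.image _).union (h2.image _)).union ((h2.prod h3).image _)).union
    (h1.image _)).union (h1.image _)).union (Set.finite_singleton _)

theorem next_mem_bounded {R : ℕ} (ht : t.length ≤ R)
    (hD : ∀ a b r, D a b = some (some r) → r.length ≤ R) (q : DecoderState Θ Λ)
    (hq : q ∈ bounded Θ Λ N L R) (x : Option Bool) (θ : Θ) :
    (control N L D t).next q x θ ∈ bounded Θ Λ N L R := by
  rcases q with (_ | ⟨y, r⟩) | a | ⟨a, b⟩ | (_ | ⟨y, r⟩) | (_ | ⟨y, r⟩) | _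
  · simp [control, bounded]
  · simp [control, bounded] at hq ⊢; omega
  · simp only [control]
    split_ifs with h <;> simp [bounded] at hq ⊢ <;> omega
  · simp only [control]
    split
    · next r h => simpa [bounded] using hD _ _ _ h
    · simpa [bounded] using ht
    · cases x with
      | none => exact hq
      | some x =>
        simp only [Option.elim]
        split_ifs with h
        · simp [bounded] at hq ⊢; omega
        · exact hq
  · simp [control, bounded]
  · simp [control, bounded] at hq ⊢; omega
  · cases x <;> simp [control, bounded]
  · simp [control, bounded] at hq ⊢; omega
  · simp [control, bounded]

/-- A configuration that is repeated forever. -/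
def Dead (C : Control (DecoderState Θ Λ) Θ Λ) (α : ℕ → Θ) (c : Cfg (DecoderState Θ Λ) Λ) : Prop :=
  C.step α c = c ∧ c.state ≠ halt

/-- Runs on an input and on a proper extension of it agree, as long as none of them is stuck. -/
def Agree (z : List Bool) (c c' : Cfg (DecoderState Θ Λ) Λ) : Prop :=
  c.state = c'.state ∧ c.state ≠ halt ∧ c.pos = c'.pos ∧ c'.input = c.input ++ z

theorem agree_step {z : List Bool} (hz : z ≠ []) {c c' : Cfg (DecoderState Θ Λ) Λ}
    (h : Agree z c c') : Agree z ((control N L D t).step α c) ((control N L D t).step α c') ∨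
      Dead (control N L D t) α c ∨ Dead (control N L D t) α c' := by
  obtain ⟨q, u, k, o⟩ := c
  obtain ⟨q', u', k', o'⟩ := c'
  obtain ⟨y, z, rfl⟩ := List.exists_cons_of_ne_nil hz
  simp only [Agree] at h
  obtain ⟨rfl, hq, rfl, rfl⟩ := h
  rcases q with (_ | ⟨x, r⟩) | a | ⟨a, b⟩ | (_ | ⟨x, r⟩) | (_ | ⟨x, r⟩) | _
  · left; simp [Agree, step_skip_nil]
  · left; simp [Agree, step_skip_cons]
  · left
    rcases lt_or_ge a.length N with h | h
    · simp [Agree, step_read _ _ _ _ h]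
    · simp [Agree, step_read_of_le _ _ _ _ h]
  · by_cases h : ∃ m, D a b = some m
    · left
      obtain ⟨m, hm⟩ := h
      cases m <;> simp [Agree, step_decode_some _ _ _ _ _ _ hm]
    · have hm : D a b = none := by simpa [Option.eq_none_iff_forall_ne_some] using h
      rcases lt_or_ge b.length L with hb | hb
      · cases u with
        | nil => right; left; simp [Dead, step_decode_nil _ _ _ _ hm]
        | cons x u => left; simp [Agree, step_decode_cons _ _ _ _ _ _ hm hb]
      · right; left
        simp [Dead, step_decode_of_le _ _ _ _ _ hm hb]
  · left; simp [Agree, step_emit_nil]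
  · left; simp [Agree, step_emit_cons]
  · right; right
    cases u <;> simp [Dead, step_finish_nil_cons]
  · left; simp [Agree, step_finish_cons]
  · exact absurd rfl hq

theorem prefix_eq_of_halts {q₀ : DecoderState Θ Λ} (hq₀ : q₀ ≠ halt) {u z : List Bool} {n n' : ℕ}
    (h : (((control N L D t).step α)^[n] ⟨q₀, u, 0, []⟩).state = halt)
    (h' : (((control N L D t).step α)^[n'] ⟨q₀, u ++ z, 0, []⟩).state = halt) : z = [] := by
  by_contra hz
  have hdead : ∀ c, Dead (control N L D t) α c → Dead (control N L D t) α
      ((control N L D t).step α c) := fun c hc => by rwa [hc.1]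
  have hhalt : ∀ c : Cfg (DecoderState Θ Λ) Λ, c.state = halt → ∀ m,
      (((control N L D t).step α)^[m] c).state = halt := by
    intro c hc m
    have : (control N L D t).step α c = c := by
      simp [Control.step, control, hc]
    rwa [Function.iterate_fixed this]
  have key : ∀ m, Agree z (((control N L D t).step α)^[m] ⟨q₀, u, 0, []⟩)
      (((control N L D t).step α)^[m] ⟨q₀, u ++ z, 0, []⟩) ∨
      Dead (control N L D t) α (((control N L D t).step α)^[m] ⟨q₀, u, 0, []⟩) ∨
      Dead (control N L D t) α (((control N L D t).step α)^[m] ⟨q₀, u ++ z, 0, []⟩) := by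
    intro m
    induction m with
    | zero => left; simpa [Agree] using hq₀
    | succ m ih =>
      rw [Function.iterate_succ_apply', Function.iterate_succ_apply']
      rcases ih with ih | ih | ih
      · rcases agree_step hz ih with h1 | h1 | h1
        · exact Or.inl h1
        · exact Or.inr (Or.inl (hdead _ h1))
        · exact Or.inr (Or.inr (hdead _ h1))
      · exact Or.inr (Or.inl (hdead _ ih))
      · exact Or.inr (Or.inr (hdead _ ih))
  have h1 := hhalt _ h n'
  have h2 := hhalt _ h' n
  rw [← Function.iterate_add_apply, add_comm] at h1
  rw [← Function.iterate_add_apply] at h2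
  rcases key (n + n') with h3 | h3 | h3
  · exact h3.2.1 h1
  · exact h3.2 h1
  · exact h3.2 h2

theorem eq_halt_of_isStop {q : DecoderState Θ Λ} (hq : (control N L D t).isStop q = true) :
    q = halt := by
  cases q <;> simp_all [control]

end DecoderState

open DecoderState in
/-- A prefix code for blocks is decoded by a prefix free oracle machine. -/
theorem exists_prefixFree_decoder {Θ Λ : Type*} [Finite Θ] [Finite Λ] {N : ℕ}
    {c : List Θ → Option (Fin N → Λ) → List Bool} (hc : ∀ a m m', c a m <+: c a m' → m = m')
    (s t : List Λ) : ∃ M : OracleMachine Θ Λ, M.PrefixFree ∧ ∀ α ω K,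
      M.Outputs α (encode N c α ω s.length K)
        (s ++ ((List.range (K * N)).map fun i => ω (s.length + i)) ++ t) := by
  have hfin : {a : List Θ | a.length = N}.Finite :=
    (List.finite_length_le Θ N).subset fun a ha => le_of_eq ha
  obtain ⟨L, hL⟩ : ∃ L, ∀ a : List Θ, a.length = N → ∀ m, (c a m).length ≤ L := by
    obtain ⟨L, hL⟩ := ((hfin.prod (Set.finite_univ (α := Option (Fin N → Λ)))).image
      fun p => (c p.1 p.2).length).bddAbove
    exact ⟨L, fun a ha m => hL ⟨(a, m), ⟨ha, trivial⟩, rfl⟩⟩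
  set R := max s.length (max t.length N)
  obtain ⟨M, hM⟩ := (control N L (table N c) t).exists_oracleMachine (bounded Θ Λ N L R)
    (finite_bounded N L R) (skip s) (by simp [bounded, R])
    (next_mem_bounded (by simp [R]) fun a b r h => by
      rw [table] at h
      split_ifs at h with h1
      obtain ⟨r', -, rfl⟩ := Option.map_eq_some_iff.1 (Option.some.inj h)
      simp [R])
  refine ⟨M, fun α u hu u' hu' huu' => ?_, fun α ω K => ?_⟩
  · obtain ⟨v, hv⟩ := hu
    obtain ⟨v', hv'⟩ := hu'
    obtain ⟨z, rfl⟩ := huu'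
    obtain ⟨n, hn, -⟩ := (hM _ _ _).1 hv
    obtain ⟨n', hn', -⟩ := (hM _ _ _).1 hv'
    rw [prefix_eq_of_halts (by simp) (eq_halt_of_isStop hn) (eq_halt_of_isStop hn'),
      List.append_nil]
  · rw [hM]
    obtain ⟨k, hk⟩ := reaches_encode (t := t) (α := α) hc hL ω K s.length s
    obtain ⟨n, hn⟩ := (reaches_skip s (encode N c α ω s.length K) 0 []).trans
      (by simpa using hk)
    exact ⟨n, by rw [hn]; rfl, by rw [hn]; simp⟩

end OracleMachine

section PrefixCode

theorem card_filter_prefix_ofFn_le (p : List Bool) {n : ℕ} (hn : p.length ≤ n) :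
    (Finset.univ.filter fun u : Fin n → Bool => p <+: List.ofFn u).card ≤ 2 ^ (n - p.length) := by
  obtain ⟨m, rfl⟩ : ∃ m, n = p.length + m := ⟨n - p.length, by omega⟩
  rw [Finset.card_filter, sum_ofFn_add p.length m fun u : List Bool => if p <+: u then 1 else 0,
    Finset.sum_comm]
  calc _ ≤ ∑ v : Fin m → Bool, 1 := by
        refine Finset.sum_le_sum fun v _ => ?_
        rw [← Finset.card_filter, Finset.card_le_one]
        intro a ha b hb
        rw [Finset.mem_filter, List.prefix_iff_eq_take, List.take_left' (by simp)] at ha hb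
        exact List.ofFn_injective (ha.2.symm.trans hb.2)
    _ = _ := by simp

/-- The converse of Kraft's inequality. -/
theorem exists_prefix_code {W : Type*} [Fintype W] (l : W → ℕ)
    (hl : ∑ w, (1 / 2 : ℝ) ^ l w ≤ 1) : ∃ c : W → List Bool,
      (∀ w, (c w).length = l w) ∧ ∀ w w', c w <+: c w' → w = w' := by
  classical
  suffices h : ∀ s : Finset W, ∃ c : W → List Bool,
      (∀ w ∈ s, (c w).length = l w) ∧ ∀ w ∈ s, ∀ w' ∈ s, c w <+: c w' → w = w' by
    obtain ⟨c, h1, h2⟩ := h Finset.univ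
    exact ⟨c, fun w => h1 w (Finset.mem_univ _),
      fun w w' => h2 w (Finset.mem_univ _) w' (Finset.mem_univ _)⟩
  intro s
  induction s using Finset.induction_on_max_value l with
  | empty => exact ⟨fun _ => [], by simp, by simp⟩
  | insert a s ha hmax ih =>
    obtain ⟨c, h1, h2⟩ := ih
    have h3 : ∑ w ∈ s, (1 / 2 : ℝ) ^ l w < 1 := by
      have h4 : ∑ w ∈ insert a s, (1 / 2 : ℝ) ^ l w ≤ 1 :=
        (Finset.sum_le_univ_sum_of_nonneg fun w => by positivity).trans hl
      rw [Finset.sum_insert ha] at h4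
      have : (0 : ℝ) < (1 / 2) ^ l a := by positivity
      linarith
    have h5 : ∑ w ∈ s, 2 ^ (l a - l w) < 2 ^ l a := by
      have h6 : ∑ w ∈ s, (2 : ℝ) ^ (l a - l w) = 2 ^ l a * ∑ w ∈ s, (1 / 2 : ℝ) ^ l w := by
        rw [Finset.mul_sum]
        refine Finset.sum_congr rfl fun w hw => ?_
        have : (2 : ℝ) ^ l a = 2 ^ (l a - l w) * 2 ^ l w := by
          rw [← pow_add, Nat.sub_add_cancel (hmax w hw)]
        rw [this, mul_assoc, ← mul_pow]
        norm_num
      have h7 : (0 : ℝ) < 2 ^ l a := by positivity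
      have : ((∑ w ∈ s, 2 ^ (l a - l w) : ℕ) : ℝ) < ((2 ^ l a : ℕ) : ℝ) := by
        push_cast
        rw [h6]
        nlinarith
      exact_mod_cast this
    have h8 : (s.biUnion fun w => Finset.univ.filter fun u : Fin (l a) → Bool =>
        c w <+: List.ofFn u).card < (Finset.univ : Finset (Fin (l a) → Bool)).card := by
      refine (Finset.card_biUnion_le.trans (Finset.sum_le_sum fun w hw => ?_)).trans_lt
        (h5.trans_eq (by simp))
      have := card_filter_prefix_ofFn_le (c w) (n := l a) (by rw [h1 w hw]; exact hmax w hw)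
      rwa [h1 w hw] at this
    obtain ⟨u, -, hu⟩ := Finset.exists_mem_notMem_of_card_lt_card h8
    simp only [Finset.mem_biUnion, Finset.mem_filter, Finset.mem_univ, true_and, not_exists,
      not_and] at hu
    have hne : ∀ w ∈ s, w ≠ a := fun w hw h => ha (h ▸ hw)
    refine ⟨Function.update c a (List.ofFn u), ?_, ?_⟩
    · intro w hw
      rcases Finset.mem_insert.1 hw with rfl | hw
      · simp
      · rw [Function.update_of_ne (hne w hw), h1 w hw]
    · intro w hw w' hw' hp
      rcases Finset.mem_insert.1 hw with h | hws <;> rcases Finset.mem_insert.1 hw' with h' | hws'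
      · rw [h, h']
      · rw [h, Function.update_self, Function.update_of_ne (hne w' hws')] at hp
        have h9 := hp.eq_of_length_le (by rw [h1 w' hws', List.length_ofFn]; exact hmax w' hws')
        exact absurd (h9 ▸ List.prefix_refl _) (hu w' hws')
      · rw [h', Function.update_self, Function.update_of_ne (hne w hws)] at hp
        exact absurd hp (hu w hws)
      · rw [Function.update_of_ne (hne w hws), Function.update_of_ne (hne w' hws')] at hp
        exact h2 w hws w' hws' hp

/-- Shannon codes. -/
theorem exists_shannon_code {W : Type*} [Fintype W] {q : W → ℝ} (hq : ∀ w, 0 < q w)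
    (hq1 : ∑ w, q w ≤ 1) : ∃ c : W → List Bool,
      (∀ w, ((c w).length : ℝ) ≤ -Real.logb 2 (q w) + 1) ∧ ∀ w w', c w <+: c w' → w = w' := by
  have hle : ∀ w, q w ≤ 1 := fun w =>
    (Finset.single_le_sum (fun i _ => (hq i).le) (Finset.mem_univ w)).trans hq1
  obtain ⟨c, h1, h2⟩ := exists_prefix_code (fun w => ⌈-Real.logb 2 (q w)⌉₊) <| by
    refine (Finset.sum_le_sum fun w _ => ?_).trans hq1
    have h3 := Nat.le_ceil (-Real.logb 2 (q w))
    calc (1 / 2 : ℝ) ^ ⌈-Real.logb 2 (q w)⌉₊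
        = 2 ^ (-(⌈-Real.logb 2 (q w)⌉₊ : ℝ)) := by
          rw [Real.rpow_neg two_pos.le, Real.rpow_natCast, one_div, inv_pow]
      _ ≤ 2 ^ Real.logb 2 (q w) :=
          Real.rpow_le_rpow_of_exponent_le one_le_two (by linarith)
      _ = q w := Real.rpow_logb two_pos (by norm_num) (hq w)
  refine ⟨c, fun w => ?_, h2⟩
  rw [h1]
  exact (Nat.ceil_lt_add_one
    (neg_nonneg.2 (Real.logb_nonpos one_lt_two (hq w).le (hle w)))).le

end PrefixCode

/-- Splitting a sum into progressions of difference `N`, one of which is at most the average. -/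
theorem exists_mul_sum_progression_le (g : ℕ → ℕ) {N : ℕ} (hN : 1 ≤ N) (K : ℕ) :
    ∃ j < N, N * ∑ i ∈ Finset.range K, g (j + i * N) ≤ ∑ k ∈ Finset.range (K * N), g k := by
  have h1 : ∑ j ∈ Finset.range N, ∑ i ∈ Finset.range K, g (j + i * N) =
      ∑ k ∈ Finset.range (K * N), g k := by
    induction K with
    | zero => simp
    | succ K ih =>
      rw [Nat.succ_mul, Finset.sum_range_add, ← ih, ← Finset.sum_add_distrib]
      exact Finset.sum_congr rfl fun j _ => by rw [Finset.sum_range_succ, add_comm j (K * N)]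
  by_contra! h
  have h2 : ∑ j ∈ Finset.range N, ∑ k ∈ Finset.range (K * N), g k <
      ∑ j ∈ Finset.range N, N * ∑ i ∈ Finset.range K, g (j + i * N) :=
    Finset.sum_lt_sum_of_nonempty (Finset.nonempty_range_iff.2 (by omega))
      fun j hj => h j (Finset.mem_range.1 hj)
  rw [← Finset.mul_sum, h1] at h2
  simp at h2

namespace OracleMachine

variable {Θ Λ : Type*}

theorem condComplexity_le {M : OracleMachine Θ Λ} {α : ℕ → Θ} {u : List Bool} {v : List Λ}
    (h : M.Outputs α u v) : M.condComplexity v α ≤ u.length :=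
  iInf₂_le u h

theorem length_encode {N : ℕ} (c : List Θ → Option (Fin N → Λ) → List Bool) (α : ℕ → Θ)
    (ω : ℕ → Λ) (k K : ℕ) : (DecoderState.encode N c α ω k K).length =
      ∑ i ∈ Finset.range K, (c (List.ofFn fun x : Fin N => α (k + i * N + x))
        (some fun x => ω (k + i * N + x))).length +
      (c (List.ofFn fun x : Fin N => α (k + K * N + x)) none).length := by
  induction K generalizing k with
  | zero => simp [DecoderState.encode]
  | succ K ih =>
    rw [DecoderState.encode, List.length_append, ih, Finset.sum_range_succ']
    simp only [Nat.succ_mul, zero_mul, add_zero]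
    have : ∀ i, k + N + i = k + (i + N) := fun i => by omega
    simp only [this]
    omega

/-- Block codes bound the complexity with respect to a universal machine. -/
theorem exists_condComplexity_le [Finite Θ] [Finite Λ] {U : OracleMachine Θ Λ}
    (hU : U.IsUniversal ∨ U.IsUniversalPrefixFree) {N : ℕ}
    {c : List Θ → Option (Fin N → Λ) → List Bool} (hc : ∀ a m m', c a m <+: c a m' → m = m') :
    ∃ B : ℕ, ∀ (α : ℕ → Θ) (ω : ℕ → Λ) (j K r : ℕ), j ≤ N → r ≤ 2 * N →
      U.condComplexity ((List.range (j + K * N + r)).map ω) α ≤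
        ((B + ∑ i ∈ Finset.range K, (c (List.ofFn fun x : Fin N => α (j + i * N + x))
          (some fun x => ω (j + i * N + x))).length : ℕ) : ℕ∞) := by
  have hM : ∀ s t : List Λ, ∃ w : List Bool, ∀ α ω K,
      U.Outputs α (w ++ DecoderState.encode N c α ω s.length K)
        (s ++ ((List.range (K * N)).map fun i => ω (s.length + i)) ++ t) := by
    intro s t
    obtain ⟨M, hM, hM'⟩ := exists_prefixFree_decoder hc s t
    obtain ⟨w, hw⟩ : U.Simulates M := hU.elim (fun h => h M) fun h => h.2 M hM
    exact ⟨w, fun α ω K => (hw _ _ _).2 (hM' α ω K)⟩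
  choose w hw using hM
  obtain ⟨B₁, hB₁⟩ := (((List.finite_length_le Λ N).prod (List.finite_length_le Λ (2 * N))).image
    fun p => (w p.1 p.2).length).bddAbove
  obtain ⟨B₂, hB₂⟩ := ((List.finite_length_le Θ N).image fun a => (c a none).length).bddAbove
  refine ⟨B₁ + B₂, fun α ω j K r hj hr => ?_⟩
  set s := (List.range j).map ω with hs
  set t := (List.range r).map fun i => ω (j + K * N + i) with ht
  have hsl : s.length = j := by simp [hs]
  have hv : (List.range (j + K * N + r)).map ω =
      s ++ ((List.range (K * N)).map fun i => ω (s.length + i)) ++ t := by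
    simp [hs, ht, List.range_add, Function.comp_def, add_assoc]
  rw [hv]
  refine (condComplexity_le (hw s t α ω K)).trans ?_
  rw [List.length_append, length_encode, hsl]
  have h1 : (w s t).length ≤ B₁ := hB₁ ⟨(s, t), ⟨by simpa [hs] using hj, by simpa [ht] using hr⟩, rfl⟩
  have h2 : (c (List.ofFn fun x : Fin N => α (j + K * N + x)) none).length ≤ B₂ :=
    hB₂ ⟨_, by simp, rfl⟩
  exact_mod_cast (by omega)

end OracleMachine

namespace BundleRDS

variable {Θ X ι : Type*} [Fintype Θ] [MeasurableSpace Θ] [MeasurableSingletonClass Θ]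
  [MeasurableSpace X] [Fintype ι] {ν : Measure (ℕ → Θ)} [IsProbabilityMeasure ν]
  {μ : Measure X} [IsProbabilityMeasure μ] {T : Θ → X → X} {π : X → ι}

omit [Fintype Θ] [MeasurableSpace Θ] [MeasurableSingletonClass Θ] [IsProbabilityMeasure μ] in
theorem exists_block_code [Nonempty Θ] [Nonempty ι]
    (hsum : ∀ (α : ℕ → Θ) n, ∑ v : Fin n → ι, cylProb μ T π α (List.ofFn v) = 1) (N : ℕ) :
    ∃ c : List Θ → Option (Fin N → ι) → List Bool, (∀ a m m', c a m <+: c a m' → m = m') ∧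
      ∀ (α : ℕ → Θ) (v : Fin N → ι), 0 < cylProb μ T π α (List.ofFn v) →
        ((c (List.ofFn fun i : Fin N => α i) (some v)).length : ℝ) ≤
          -Real.logb 2 (cylProb μ T π α (List.ofFn v)) + 3 := by
  have hcard : (0 : ℝ) < Fintype.card (Fin N → ι) := by exact_mod_cast Fintype.card_pos
  have h := fun a : List Θ => exists_shannon_code (W := Option (Fin N → ι))
    (q := fun m => m.elim (1 / 2) fun v =>
      (cylProb μ T π (fun i => a.getD i (Classical.arbitrary Θ)) (List.ofFn v) +
        1 / Fintype.card (Fin N → ι)) / 4) (fun m => ?_) ?_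
  · choose c hc hc' using h
    refine ⟨c, hc', fun α v hv => (hc _ _).trans ?_⟩
    have h1 : cylProb μ T π (fun i => (List.ofFn fun i : Fin N => α i).getD i
        (Classical.arbitrary Θ)) (List.ofFn v) = cylProb μ T π α (List.ofFn v) :=
      dependsOn_cylProb (List.ofFn v) fun i hi => by
        have hi' : i < N := by simpa using hi
        simp [hi']
    simp only [Option.elim, h1]
    have h2 : Real.logb 2 (cylProb μ T π α (List.ofFn v) / 4) ≤
        Real.logb 2 ((cylProb μ T π α (List.ofFn v) + 1 / Fintype.card (Fin N → ι)) / 4) := by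
      refine Real.logb_le_logb_of_le one_lt_two (by positivity) ?_
      have : 0 < 1 / (Fintype.card (Fin N → ι) : ℝ) := by positivity
      linarith
    have h3 : Real.logb 2 (4 : ℝ) = 2 := by
      rw [show (4 : ℝ) = 2 ^ (2 : ℕ) by norm_num, Real.logb_pow, Real.logb_self_eq_one one_lt_two]
      norm_num
    rw [Real.logb_div hv.ne' (by norm_num), h3] at h2
    linarith
  · cases m with
    | none => norm_num
    | some v =>
      have := cylProb_nonneg (μ := μ) (T := T) (π := π)
        (fun i => a.getD i (Classical.arbitrary Θ)) (List.ofFn v)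
      simp only [Option.elim]
      positivity
  · rw [Fintype.sum_option]
    simp only [Option.elim]
    rw [← Finset.sum_div, Finset.sum_add_distrib, hsum]
    simp only [Finset.sum_const, Finset.card_univ, nsmul_eq_mul]
    rw [mul_one_div_cancel hcard.ne']
    norm_num

theorem ae_eventually_condComplexity_le [Nonempty Θ] [Nonempty ι]
    (hT : ∀ θ, MeasurePreserving (T θ) μ μ)
    (hπ : ∀ i, MeasurableSet (π ⁻¹' {i})) (hS : Ergodic (skewProduct T) (ν.prod μ))
    {U : OracleMachine Θ ι} (hU : U.IsUniversal ∨ U.IsUniversalPrefixFree) {N : ℕ} (hN : 1 ≤ N)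
    {b : ℝ} (hb : ∫ p, info μ T π N p ∂(ν.prod μ) + 3 < N * b) :
    ∀ᵐ p ∂(ν.prod μ), ∀ᶠ n : ℕ in atTop,
      (U.condComplexity (itinerary T π p.1 p.2 n) p.1 : ℝ≥0∞) ≤ ENNReal.ofReal (b * n) := by
  have hTm := fun θ => (hT θ).measurable
  obtain ⟨c, hc, hlen⟩ := exists_block_code (fun α n => sum_cylProb (μ := μ) hTm hπ α n) N
  obtain ⟨B, hB⟩ := OracleMachine.exists_condComplexity_le hU hc
  set f : (ℕ → Θ) × X → ℕ := fun p => (c (List.ofFn fun i : Fin N => p.1 i)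
    (some fun i => π (fiberMap T p.1 i p.2))).length with hf
  classical
  have hcode : ∀ v : List ι, v.length = N → DependsOn (fun α : ℕ → Θ =>
      ((c (List.ofFn fun i : Fin N => α i) (if h : v.length = N then
        some (fun i : Fin N => v[i]) else none)).length : ℝ)) (Set.Iio N) := by
    intro v hv α α' h
    have : ∀ i : Fin N, α i = α' i := fun i => h i i.2
    simp only [this]
  have hf' : ∀ p, (f p : ℝ) = ((c (List.ofFn fun i : Fin N => p.1 i)
      (if h : (itinerary T π p.1 p.2 N).length = N then
        some (fun i : Fin N => (itinerary T π p.1 p.2 N)[i]) else none)).length : ℝ) := by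
    intro p
    simp [hf, itinerary]
  obtain ⟨M, hM⟩ := exists_abs_comp_itinerary_le T π N hcode
  have hfm : Measurable fun p => (f p : ℝ) := by
    simp only [hf']
    exact measurable_local_comp_itinerary hTm hπ N hcode
  have hfi : Integrable (fun p => (f p : ℝ)) (ν.prod μ) := by
    simp only [hf']
    exact integrable_comp_itinerary hTm hπ N hcode
  have hint : ∫ p, (f p : ℝ) ∂(ν.prod μ) < N * b := by
    refine lt_of_le_of_lt ?_ hb
    have h1 : ∫ p, info μ T π N p ∂(ν.prod μ) + 3 =
        ∫ p, (info μ T π N p + 3) ∂(ν.prod μ) := by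
      rw [integral_add (integrable_info hTm hπ N) (integrable_const _)]
      simp
    rw [h1]
    refine integral_mono_ae hfi ((integrable_info hTm hπ N).add (integrable_const _)) ?_
    filter_upwards [ae_cylProb_itinerary_pos (ν := ν) (μ := μ) hTm hπ] with p hp
    have h2 := hp N
    simp only [info]
    rw [itinerary_eq_ofFn] at h2 ⊢
    exact hlen _ _ h2
  obtain ⟨b', hb', hb''⟩ := exists_between hint
  filter_upwards [hS.ae_eventually_birkhoffSum_lt hfm (fun p => (hf' p) ▸ hM p) hb'] with p hp
  obtain ⟨n₀, hn₀⟩ := exists_nat_ge (N * B / (N * b - b'))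
  filter_upwards [hp, eventually_ge_atTop N, eventually_ge_atTop n₀] with n hn hnN hnn₀
  have hn1 : 1 ≤ n / N := (Nat.one_le_div_iff (by omega)).2 hnN
  have hdiv : n / N * N + n % N = n := Nat.div_add_mod' n N
  have hmod : n % N < N := Nat.mod_lt _ (by omega)
  obtain ⟨K, hK⟩ : ∃ K, n / N = K + 1 := ⟨n / N - 1, by omega⟩
  rw [hK, Nat.succ_mul] at hdiv
  obtain ⟨j, hj, hjK⟩ := exists_mul_sum_progression_le (fun k => f ((skewProduct T)^[k] p)) hN K
  have h1 := hB p.1 (fun i => π (fiberMap T p.1 i p.2)) j K (n - (j + K * N)) hj.le (by omega)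
  rw [Nat.add_sub_cancel' (by omega)] at h1
  have h2 : ∀ k, f ((skewProduct T)^[k] p) = (c (List.ofFn fun x : Fin N => p.1 (k + x))
      (some fun x => π (fiberMap T p.1 (k + x) p.2))).length := by
    intro k
    simp only [hf, skewProduct_iterate, shift_iterate_apply, fiberMap_add, add_comm]
  simp only [← h2] at h1
  have h3 : (∑ k ∈ Finset.range (K * N), f ((skewProduct T)^[k] p) : ℝ) ≤ b' * n := by
    refine le_trans ?_ hn.le
    exact Finset.sum_le_sum_of_subset_of_nonneg (Finset.range_mono (by omega))
      fun _ _ _ => Nat.cast_nonneg _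
  have h4 : (B + ∑ i ∈ Finset.range K, f ((skewProduct T)^[j + i * N] p) : ℕ) ≤ b * n := by
    have hNpos : (0 : ℝ) < N := by exact_mod_cast hN
    have h5 : (N : ℝ) * ∑ i ∈ Finset.range K, (f ((skewProduct T)^[j + i * N] p) : ℝ) ≤
        ∑ k ∈ Finset.range (K * N), (f ((skewProduct T)^[k] p) : ℝ) := by exact_mod_cast hjK
    have h6 : (n₀ : ℝ) ≤ n := by exact_mod_cast hnn₀
    rw [div_le_iff₀ (by linarith)] at hn₀
    have h7 : (n₀ : ℝ) * (N * b - b') ≤ n * (N * b - b') :=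
      mul_le_mul_of_nonneg_right h6 (by linarith)
    push_cast
    refine le_of_mul_le_mul_left ?_ hNpos
    linarith
  calc (U.condComplexity (itinerary T π p.1 p.2 n) p.1 : ℝ≥0∞)
      ≤ ((B + ∑ i ∈ Finset.range K, f ((skewProduct T)^[j + i * N] p) : ℕ) : ℝ≥0∞) := by
        exact (ENat.toENNReal_le.2 h1).trans_eq (ENat.toENNReal_coe _)
    _ = ENNReal.ofReal ((B + ∑ i ∈ Finset.range K, f ((skewProduct T)^[j + i * N] p) : ℕ) : ℝ) :=
        (ENNReal.ofReal_natCast _).symm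
    _ ≤ _ := ENNReal.ofReal_le_ofReal h4

end BundleRDS

namespace OracleMachine

variable {Θ Λ : Type*}

theorem iterate_step_of_isStop {M : OracleMachine Θ Λ} {α : ℕ → Θ} {c : M.Config}
    (h : M.isStop c.state = true) (n : ℕ) : (M.step α)^[n] c = c :=
  Function.iterate_fixed (by simp [step, h]) n

theorem Outputs.unique {M : OracleMachine Θ Λ} {α : ℕ → Θ} {u : List Bool} {v v' : List Λ}
    (h : M.Outputs α u v) (h' : M.Outputs α u v') : v = v' := by
  obtain ⟨n, hn, rfl⟩ := h
  obtain ⟨n', hn', rfl⟩ := h'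
  have h1 := iterate_step_of_isStop (α := α) hn n'
  have h2 := iterate_step_of_isStop (α := α) hn' n
  rw [← Function.iterate_add_apply] at h1 h2
  rw [← h1, ← h2, add_comm]

theorem oraclePos_iterate_step_le (M : OracleMachine Θ Λ) (α : ℕ → Θ) (u : List Bool) (n : ℕ) :
    ((M.step α)^[n] (M.init u)).oraclePos ≤ n := by
  induction n with
  | zero => simp [init]
  | succ n ih =>
    rw [Function.iterate_succ_apply']
    simp only [step]
    split_ifs
    · omega
    all_goals dsimp only; omega

theorem dependsOn_iterate_step (M : OracleMachine Θ Λ) (u : List Bool) (n : ℕ) :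
    DependsOn (fun α => (M.step α)^[n] (M.init u)) (Set.Iio n) := by
  induction n with
  | zero => intro _ _ _; rfl
  | succ n ih =>
    intro α α' h
    have h1 := ih fun i hi => h i (Nat.lt_succ_of_lt hi)
    simp only at h1
    have h2 := h _ (Nat.lt_succ_of_le (M.oraclePos_iterate_step_le α u n))
    simp only [Function.iterate_succ_apply', ← h1]
    simp only [step, h2]

theorem measurableSet_outputs [Finite Θ] [MeasurableSpace Θ] [MeasurableSingletonClass Θ]
    (M : OracleMachine Θ Λ) (u : List Bool) (v : List Λ) :
    MeasurableSet {α | M.Outputs α u v} := by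
  have : {α | M.Outputs α u v} = ⋃ n, {α | M.isStop ((M.step α)^[n] (M.init u)).state = true ∧
      ((M.step α)^[n] (M.init u)).output = v} := by
    ext α
    simp [Outputs]
  rw [this]
  refine .iUnion fun n => measurableSet_setOfPred.2 (DependsOn.measurable_of_finite (n := n) ?_)
  intro α α' h
  have := M.dependsOn_iterate_step u n h
  simp only at this
  simp only [this]

end OracleMachine

namespace BundleRDS

section LowerBound

variable {Θ X ι : Type*} [Fintype Θ] [MeasurableSpace Θ] [MeasurableSingletonClass Θ]
  [MeasurableSpace X] [Fintype ι] {ν : Measure (ℕ → Θ)} [IsProbabilityMeasure ν]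
  {μ : Measure X} [IsProbabilityMeasure μ] {T : Θ → X → X} {π : X → ι}

omit [Fintype Θ] [MeasurableSpace Θ] [MeasurableSingletonClass Θ] [Fintype ι] in
/-- Few points have itineraries with a short description but of small probability. -/
theorem measure_exists_outputs_le (U : OracleMachine Θ ι) (α : ℕ → Θ) (n k : ℕ) (b : ℝ) :
    μ {x | ∃ u : List Bool, u.length ≤ k ∧ U.Outputs α u (itinerary T π α x n) ∧
      cylProb μ T π α (itinerary T π α x n) ≤ b} ≤ 2 ^ (k + 1) * ENNReal.ofReal b := by
  have h1 : ∀ u : List Bool, μ {x | U.Outputs α u (itinerary T π α x n) ∧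
      cylProb μ T π α (itinerary T π α x n) ≤ b} ≤ ENNReal.ofReal b := by
    intro u
    rcases Set.eq_empty_or_nonempty {x | U.Outputs α u (itinerary T π α x n) ∧
      cylProb μ T π α (itinerary T π α x n) ≤ b} with h | ⟨x, hx, hxb⟩
    · simp [h]
    · refine (measure_mono (t := {y | itinerary T π α y n = itinerary T π α x n})
        fun y hy => hy.1.unique hx).trans ?_
      rw [cylProb, length_itinerary, measureReal_def] at hxb
      exact (ENNReal.le_ofReal_iff_toReal_le (measure_ne_top _ _) (ENNReal.toReal_nonneg.trans hxb)).2
        hxb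
  calc _ ≤ μ (⋃ j ∈ Finset.range (k + 1), ⋃ w : Fin j → Bool,
        {x | U.Outputs α (List.ofFn w) (itinerary T π α x n) ∧
          cylProb μ T π α (itinerary T π α x n) ≤ b}) := by
        refine measure_mono fun x hx => ?_
        obtain ⟨u, hu, hx⟩ := hx
        obtain ⟨j, hj⟩ : ∃ j, u.length = j := ⟨_, rfl⟩
        obtain ⟨w, rfl⟩ := List.exists_ofFn_eq u hj
        simp only [Set.mem_iUnion]
        exact ⟨j, Finset.mem_range.2 (Nat.lt_succ_of_le (by simpa using hu)), w, hx⟩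
    _ ≤ ∑ j ∈ Finset.range (k + 1), ∑ w : Fin j → Bool, ENNReal.ofReal b :=
        (measure_biUnion_finset_le _ _).trans (Finset.sum_le_sum fun j _ =>
          (measure_iUnion_fintype_le _ _).trans (Finset.sum_le_sum fun w _ => h1 _))
    _ = (∑ j ∈ Finset.range (k + 1), 2 ^ j : ℕ) * ENNReal.ofReal b := by
        simp [Finset.sum_mul]
    _ ≤ _ := by
        gcongr
        have := Nat.geomSum_lt (n := k + 1) (s := Finset.range (k + 1)) le_rfl
          (fun j hj => Finset.mem_range.1 hj)
        exact_mod_cast this.le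

theorem ae_eventually_le_condComplexity (hT : ∀ θ, Measurable (T θ))
    (hπ : ∀ i, MeasurableSet (π ⁻¹' {i})) (U : OracleMachine Θ ι) {c c' : ℝ} (hc : 0 ≤ c)
    (hcc' : c < c') (hinfo : ∀ᵐ p ∂(ν.prod μ), ∀ᶠ n : ℕ in atTop, c' * n < info μ T π n p) :
    ∀ᵐ p ∂(ν.prod μ), ∀ᶠ n : ℕ in atTop,
      ENNReal.ofReal (c * n) ≤ (U.condComplexity (itinerary T π p.1 p.2 n) p.1 : ℝ≥0∞) := by
  set E : ℕ → (ℕ → Θ) × X → Prop := fun n p => ∃ u : List Bool, u.length ≤ ⌊c * n⌋₊ ∧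
    U.Outputs p.1 u (itinerary T π p.1 p.2 n) ∧
      cylProb μ T π p.1 (itinerary T π p.1 p.2 n) ≤ 2 ^ (-(c' * n)) with hE
  set r : ℝ := 2 ^ (-(c' - c)) with hr
  have hr0 : 0 < r := by positivity
  have hr1 : r < 1 := Real.rpow_lt_one_of_one_lt_of_neg one_lt_two (by linarith)
  have hEm : ∀ n, MeasurableSet {p | E n p} := by
    intro n
    refine measurableSet_itinerary_mem hT hπ n (fun α => {v | ∃ u : List Bool,
      u.length ≤ ⌊c * n⌋₊ ∧ U.Outputs α u v ∧ cylProb μ T π α v ≤ 2 ^ (-(c' * n))}) fun v => ?_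
    have : {α | v ∈ {v | ∃ u : List Bool, u.length ≤ ⌊c * n⌋₊ ∧ U.Outputs α u v ∧
        cylProb μ T π α v ≤ 2 ^ (-(c' * n))}} = ⋃ u : List Bool, ⋃ _ : u.length ≤ ⌊c * n⌋₊,
          ({α | U.Outputs α u v} ∩ {α | cylProb μ T π α v ≤ 2 ^ (-(c' * n))}) := by
      ext α
      simp [and_left_comm]
    rw [this]
    exact .iUnion fun u => .iUnion fun _ => (U.measurableSet_outputs u v).inter
      (measurableSet_le (dependsOn_cylProb v).measurable_of_finite measurable_const)
  have hEle : ∀ n, (ν.prod μ) {p | E n p} ≤ ENNReal.ofReal (2 * r ^ n) := by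
    intro n
    rw [Measure.prod_apply (hEm n)]
    calc _ ≤ ∫⁻ _, ENNReal.ofReal (2 * r ^ n) ∂ν := by
          refine lintegral_mono fun α => (measure_exists_outputs_le U α n ⌊c * n⌋₊ _).trans ?_
          have h1 : (2 : ℝ≥0∞) ^ (⌊c * n⌋₊ + 1) = ENNReal.ofReal (2 ^ (⌊c * n⌋₊ + 1)) := by
            rw [ENNReal.ofReal_pow two_pos.le, ENNReal.ofReal_ofNat]
          rw [h1, ← ENNReal.ofReal_mul (by positivity)]
          refine ENNReal.ofReal_le_ofReal ?_
          have h2 : (⌊c * n⌋₊ : ℝ) ≤ c * n := Nat.floor_le (by positivity)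
          have h3 : r ^ n = 2 ^ (c * n) * 2 ^ (-(c' * n)) := by
            rw [hr, ← Real.rpow_natCast, ← Real.rpow_mul two_pos.le, ← Real.rpow_add two_pos]
            ring_nf
          have h4 : (2 : ℝ) ^ ⌊c * n⌋₊ ≤ 2 ^ (c * n) := by
            rw [← Real.rpow_natCast]
            exact Real.rpow_le_rpow_of_exponent_le one_le_two h2
          have h5 : (0 : ℝ) < 2 ^ (-(c' * n)) := by positivity
          rw [h3, pow_succ]
          nlinarith [mul_le_mul_of_nonneg_right h4 h5.le]
      _ = _ := by simp
  have hsum : ∑' n, (ν.prod μ) {p | E n p} ≠ ∞ := by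
    refine ne_top_of_le_ne_top ?_ (ENNReal.tsum_le_tsum hEle)
    rw [← ENNReal.ofReal_tsum_of_nonneg (fun n => by positivity)
      ((summable_geometric_of_lt_one hr0.le hr1).mul_left 2)]
    exact ENNReal.ofReal_ne_top
  filter_upwards [ae_eventually_notMem hsum, hinfo, ae_cylProb_itinerary_pos hT hπ]
    with p hp hpi hpos
  filter_upwards [hp, hpi] with n hn hni
  have h1 : (⌈c * n⌉₊ : ℕ∞) ≤ U.condComplexity (itinerary T π p.1 p.2 n) p.1 := by
    refine le_iInf₂ fun u hu => ?_
    rw [Nat.cast_le, Nat.ceil_le]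
    by_contra! hlt
    refine hn ⟨u, Nat.le_floor hlt.le, hu, ?_⟩
    rw [info] at hni
    rw [← Real.rpow_logb two_pos (by norm_num) (hpos n)]
    exact Real.rpow_le_rpow_of_exponent_le one_le_two (by linarith)
  calc ENNReal.ofReal (c * n) ≤ (⌈c * n⌉₊ : ℝ≥0∞) := by
        rw [← ENNReal.ofReal_natCast]
        exact ENNReal.ofReal_le_ofReal (Nat.le_ceil _)
    _ ≤ _ := by
        have := ENat.toENNReal_le.2 h1
        rwa [ENat.toENNReal_coe] at this

end LowerBound

section Partition

variable {Θ X ι : Type*} [MeasurableSpace X] [Fintype ι] {μ : Measure X} {P : ι → Set X}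

theorem IsPartition.exists_label [Nonempty ι] (hP : IsPartition μ P) : ∃ π : X → ι,
    (∀ i, MeasurableSet (π ⁻¹' {i})) ∧ ∀ᵐ x ∂μ, ∀ i, x ∈ P i ↔ π x = i := by
  classical
  set G : Set X := {x | ∃ i, x ∈ P i ∧ ∀ j, j ≠ i → x ∉ P j} with hG
  have hGm : MeasurableSet G := by
    have : G = ⋃ i, (P i ∩ ⋂ j, ⋂ _ : j ≠ i, (P j)ᶜ) := by
      ext x
      simp [hG]
    rw [this]
    exact .iUnion fun i => (hP.measurableSet i).inter
      (.iInter fun j => .iInter fun _ => (hP.measurableSet j).compl)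
  have hspec : ∀ x, ∃ i : ι, x ∈ G → x ∈ P i ∧ ∀ j, j ≠ i → x ∉ P j := by
    intro x
    by_cases hx : x ∈ G
    · obtain ⟨i, hi⟩ := hx
      exact ⟨i, fun _ => hi⟩
    · exact ⟨Classical.arbitrary ι, fun h => absurd h hx⟩
  choose f hf using hspec
  set π : X → ι := fun x => if x ∈ G then f x else Classical.arbitrary ι with hπ
  have hiff : ∀ x ∈ G, ∀ i, x ∈ P i ↔ π x = i := by
    intro x hx i
    simp only [hπ, hx, if_true]
    exact ⟨fun h => by_contra fun hne => (hf x hx).2 i (Ne.symm hne) h,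
      fun h => h ▸ (hf x hx).1⟩
  refine ⟨π, fun i => ?_, ?_⟩
  · have : π ⁻¹' {i} = (G ∩ P i) ∪ (Gᶜ ∩ {_x | Classical.arbitrary ι = i}) := by
      ext x
      by_cases hx : x ∈ G
      · simp [hx, hiff x hx i]
      · simp [hx, hπ]
    rw [this]
    exact (hGm.inter (hP.measurableSet i)).union (hGm.compl.inter (.const _))
  · have h1 : ∀ᵐ x ∂μ, ∀ i j, i ≠ j → ¬ (x ∈ P i ∧ x ∈ P j) := by
      refine ae_all_iff.2 fun i => ae_all_iff.2 fun j => ?_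
      by_cases hij : i = j
      · exact .of_forall fun x h => absurd hij h
      · have h2 : ∀ᵐ x ∂μ, x ∉ P i ∩ P j := measure_eq_zero_iff_ae_notMem.1 (hP.aedisjoint hij)
        filter_upwards [h2] with x hx _ using hx
    filter_upwards [h1, hP.cover] with x hx ⟨i, hi⟩
    exact hiff x ⟨i, hi, fun j hj hxj => hx j i hj ⟨hxj, hi⟩⟩

variable [Fintype Θ] [MeasurableSpace Θ] [MeasurableSingletonClass Θ]
  {ν : Measure (ℕ → Θ)} [IsProbabilityMeasure ν] [IsProbabilityMeasure μ] {T : Θ → X → X} {π : X → ι}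

theorem averagedEntropy_eq_integral_info (hT : ∀ θ, MeasurePreserving (T θ) μ μ)
    (hπ : ∀ i, MeasurableSet (π ⁻¹' {i})) (hPπ : ∀ᵐ x ∂μ, ∀ i, x ∈ P i ↔ π x = i) (n : ℕ) :
    averagedEntropy ν μ T P n = ∫ p, info μ T π n p ∂(ν.prod μ) := by
  have h := integral_prod_comp_itinerary (ν := ν) (μ := μ) (fun θ => (hT θ).measurable) hπ n
    (g := fun α v => -Real.logb 2 (cylProb μ T π α v)) fun v hv => dependsOn_neg_logb_cylProb v hv
  simp only [info]
  rw [h, averagedEntropy]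
  refine integral_congr_ae (.of_forall fun α => ?_)
  have h1 : ∀ v : Fin n → ι, μ.real (refinement T P α n v) = cylProb μ T π α (List.ofFn v) := by
    intro v
    refine measureReal_congr ?_
    have h2 : ∀ᵐ x ∂μ, ∀ i : ℕ, ∀ k, fiberMap T α i x ∈ P k ↔ π (fiberMap T α i x) = k :=
      ae_all_iff.2 fun i => (measurePreserving_fiberMap hT α i).quasiMeasurePreserving.ae hPπ
    filter_upwards [h2] with x hx
    refine propext ?_
    change x ∈ refinement T P α n v ↔ itinerary T π α x (List.ofFn v).length = List.ofFn v
    rw [List.length_ofFn, itinerary_eq_ofFn, List.ofFn_injective.eq_iff, funext_iff]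
    simp [refinement, hx]
  simp only [shannonEntropy, h1, mul_neg, Finset.sum_neg_distrib]

end Partition

end BundleRDS

open BundleRDS

theorem theorem2 {Θ X ι : Type*} [Fintype Θ] [MeasurableSpace Θ] [MeasurableSingletonClass Θ]
    [MeasurableSpace X] [Fintype ι]
    (ν : Measure (ℕ → Θ)) [IsProbabilityMeasure ν] (μ : Measure X) [IsProbabilityMeasure μ]
    (T : Θ → X → X)
    (hν : Ergodic (BundleRDS.shift : (ℕ → Θ) → ℕ → Θ) ν)
    (hT : ∀ θ, MeasurePreserving (T θ) μ μ)
    (hS : Ergodic (BundleRDS.skewProduct T) (ν.prod μ))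
    (P : ι → Set X) (hP : BundleRDS.IsPartition μ P)
    (U : OracleMachine Θ ι) (hU : U.IsUniversal ∨ U.IsUniversalPrefixFree) :
    Tendsto (fun n : ℕ => BundleRDS.averagedEntropy ν μ T P n / n) atTop
        (𝓝 (BundleRDS.fiberEntropy ν μ T P)) ∧
      ∀ᵐ p ∂(ν.prod μ), ∃ ω : ℕ → ι,
        BundleRDS.IsName T P p.1 p.2 ω ∧
        (∀ ω' : ℕ → ι, BundleRDS.IsName T P p.1 p.2 ω' → ω' = ω) ∧
        ((U.upperComplexity ω p.1 : ℝ≥0∞) : EReal) = (BundleRDS.fiberEntropy ν μ T P : ℝ) ∧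
        ((U.lowerComplexity ω p.1 : ℝ≥0∞) : EReal) = (BundleRDS.fiberEntropy ν μ T P : ℝ) := by
  have hTm := fun θ => (hT θ).measurable
  have hΘ : Nonempty Θ := (nonempty_of_isProbabilityMeasure ν).map fun α => α 0
  have hι : Nonempty ι := by
    obtain ⟨x, i, -⟩ := hP.cover.exists
    exact ⟨i⟩
  obtain ⟨π, hπ, hPπ⟩ := hP.exists_label
  have hH := averagedEntropy_eq_integral_info (ν := ν) hT hπ hPπ
  have hH0 : ∀ n, 0 ≤ averagedEntropy ν μ T P n := fun n =>
    hH n ▸ integral_nonneg (info_nonneg n)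
  have hsub : Subadditive (averagedEntropy ν μ T P) := fun m n => by
    rw [hH, hH, hH]
    exact integral_info_add_le hT hS.toMeasurePreserving hπ m n
  have hbdd : BddBelow (Set.range fun n : ℕ => averagedEntropy ν μ T P n / n) :=
    ⟨0, by rintro _ ⟨n, rfl⟩; exact div_nonneg (hH0 n) (Nat.cast_nonneg n)⟩
  have hlim := hsub.tendsto_lim hbdd
  have hfib : fiberEntropy ν μ T P = hsub.lim := hlim.limUnder_eq
  rw [hfib]
  refine ⟨hlim, ?_⟩
  set h := hsub.lim with hh
  have h0 : 0 ≤ h := ge_of_tendsto' hlim fun n => div_nonneg (hH0 n) (Nat.cast_nonneg n)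
  have hmul : ∀ n : ℕ, n * h ≤ ∫ p, info μ T π n p ∂(ν.prod μ) := by
    intro n
    rw [← hH]
    rcases Nat.eq_zero_or_pos n with rfl | hn
    · simpa using hH0 0
    · have h1 := hsub.lim_le_div hbdd hn.ne'
      rw [le_div_iff₀ (by exact_mod_cast hn)] at h1
      linarith
  have hupper : ∀ m : ℕ, ∀ᵐ p ∂(ν.prod μ), ∀ᶠ n : ℕ in atTop,
      (U.condComplexity (itinerary T π p.1 p.2 n) p.1 : ℝ≥0∞) ≤
        ENNReal.ofReal ((h + 1 / (m + 1)) * n) := by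
    intro m
    have h1 : Tendsto (fun n : ℕ => averagedEntropy ν μ T P n / n + 3 / n) atTop (𝓝 (h + 0)) :=
      hlim.add (tendsto_const_div_atTop_nhds_zero_nat 3)
    rw [add_zero] at h1
    have h2 : h < h + 1 / ((m : ℝ) + 1) := lt_add_of_pos_right _ (by positivity)
    obtain ⟨N, hN, hN1⟩ := ((h1.eventually (gt_mem_nhds h2)).and (eventually_ge_atTop 1)).exists
    refine ae_eventually_condComplexity_le hT hπ hS hU hN1 ?_
    have hN0 : (0 : ℝ) < N := by exact_mod_cast hN1
    rw [← hH]
    rw [← add_div, div_lt_iff₀ hN0] at hN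
    linarith
  have hlower : ∀ m : ℕ, ∀ᵐ p ∂(ν.prod μ), ∀ᶠ n : ℕ in atTop,
      ENNReal.ofReal ((h - 1 / (m + 1)) * n) ≤
        (U.condComplexity (itinerary T π p.1 p.2 n) p.1 : ℝ≥0∞) := by
    intro m
    have h2 : h - 1 / ((m : ℝ) + 1) < h := sub_lt_self _ (by positivity)
    rcases lt_or_ge (h - 1 / ((m : ℝ) + 1)) 0 with h3 | h3
    · refine .of_forall fun p => .of_forall fun n => ?_
      rw [ENNReal.ofReal_of_nonpos (mul_nonpos_of_nonpos_of_nonneg h3.le (Nat.cast_nonneg n))]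
      exact zero_le
    · obtain ⟨c, hc, hc'⟩ := exists_between h2
      exact ae_eventually_le_condComplexity hTm hπ U h3 hc (ae_eventually_lt_info hT hπ hS hmul hc')
  have hname : ∀ᵐ p ∂(ν.prod μ), ∀ n i,
      fiberMap T p.1 n p.2 ∈ P i ↔ π (fiberMap T p.1 n p.2) = i := by
    have h1 : ∀ᵐ p ∂(ν.prod μ), ∀ i, p.2 ∈ P i ↔ π p.2 = i :=
      Measure.quasiMeasurePreserving_snd.ae hPπ
    filter_upwards [hS.toMeasurePreserving.ae_iterate h1] with p hp n
    simpa only [skewProduct_iterate] using hp n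
  filter_upwards [hname, ae_all_iff.2 hupper, ae_all_iff.2 hlower] with p hp hpu hpl
  set ω : ℕ → ι := fun n => π (fiberMap T p.1 n p.2) with hω
  have hinv : Tendsto (fun m : ℕ => 1 / ((m : ℝ) + 1)) atTop (𝓝 0) :=
    tendsto_one_div_add_atTop_nhds_zero_nat
  have hup : U.upperComplexity ω p.1 ≤ ENNReal.ofReal h := by
    have h1 : Tendsto (fun m : ℕ => ENNReal.ofReal (h + 1 / ((m : ℝ) + 1))) atTop
        (𝓝 (ENNReal.ofReal h)) := by
      simpa using ENNReal.tendsto_ofReal (hinv.const_add h)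
    refine ge_of_tendsto' h1 fun m => limsup_le_of_le (by isBoundedDefault) ?_
    filter_upwards [hpu m] with n hn
    refine ENNReal.div_le_of_le_mul (hn.trans_eq ?_)
    rw [ENNReal.ofReal_mul (by positivity), ENNReal.ofReal_natCast]
  have hlow : ENNReal.ofReal h ≤ U.lowerComplexity ω p.1 := by
    have h1 : Tendsto (fun m : ℕ => ENNReal.ofReal (h - 1 / ((m : ℝ) + 1))) atTop
        (𝓝 (ENNReal.ofReal h)) := by
      simpa using ENNReal.tendsto_ofReal (hinv.const_sub h)
    refine le_of_tendsto' h1 fun m => le_liminf_of_le (by isBoundedDefault) ?_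
    filter_upwards [hpl m, eventually_gt_atTop 0] with n hn hn0
    rw [ENNReal.le_div_iff_mul_le (by simp [hn0.ne']) (by simp)]
    refine le_trans (le_of_eq ?_) hn
    rw [ENNReal.ofReal_mul' (Nat.cast_nonneg n), ENNReal.ofReal_natCast]
  have hle : U.lowerComplexity ω p.1 ≤ U.upperComplexity ω p.1 := liminf_le_limsup
  refine ⟨ω, fun n => (hp n _).2 rfl, fun ω' hω' => funext fun n => ((hp n _).1 (hω' n)).symm,
    ?_, ?_⟩
  · rw [le_antisymm hup (hlow.trans hle), EReal.coe_ennreal_ofReal, max_eq_left h0]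
  · rw [le_antisymm (hle.trans hup) hlow, EReal.coe_ennreal_ofReal, max_eq_left h0]
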